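/- **Definitions.** A *direct product structure* on a topological space $R$ is a continuous map $[\cdot,\cdot]:R\times R\to R$ with $[x,x]=x$, $[[x,y],z]=[x,z]$ and $[x,[y,z]]=[x,z]$; its *plaques* are $P_1(R,x)=\{y\in R:[x,y]=x\}$ and $P_2(R,x)=\{y\in R:[x,y]=y\}$. A *local product structure* on a space $\mathcal X$ is a covering of $\mathcal X$ by open sets, each with a direct product structure, any two of which are compatible: for every $x\in\mathcal X$ and members $R_1,R_2$ of the covering there is a neighbourhood $U$ of $x$ such that $[\cdot,\cdot]_{R_1}=[\cdot,\cdot]_{R_2}$ on $U\cap R_1\cap R_2$. A *rectangle* of $\mathcal X$ is an open subset with a direct product structure that is compatible with all members of the covering. A continuous map $\varphi$ *preserves the local product structures* if every point has a neighbourhood $R$ that is a rectangle, whose image $\varphi(R)$ is a rectangle with $\varphi([y,z]_R)=[\varphi(y),\varphi(z)]_{\varphi(R)}$ for all $y,z\in R$. A *Smale space* $(\mathcal X,f)$ is a compact metrizable space $\mathcal X$ with a local product structure and a homeomorphism $f:\mathcal X\to\mathcal X$ preserving it, such that for some metric $d$ inducing the topology and some constants $\lambda\in(0,1)$, $C>0$,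 every point of $\mathcal X$ has a neighbourhood $R$ that is a rectangle and satisfies, for all $x\in R$ and $n\ge 0$, $$d(f^n(y),f^n(z))\le C\lambda^n d(y,z)\ \text{ for } y,z\in P_1(R,x),\qquad d(f^{-n}(y),f^{-n}(z))\le C\lambda^n d(y,z)\ \text{ for } y,z\in P_2(R,x).$$ The *stable leaf* $W_+(x)$ (*unstable leaf* $W_-(x)$) is the set of $y$ with $d(f^n(x),f^n(y))\to0$ as $n\to+\infty$ (as $n\to-\infty$). The *internal topology* of $W_+(x)$ is the one defined by the log-scale $\ell_+(y,z)=\max\{n:(f^k(y),f^k(z))\in U\text{ for all }k\ge-n\}$, i.e. a set is open if and only if with each point $y$ it contains $\{z\in W_+(x):\ell_+(y,z)\ge n\}$ for some $n$; here $U$ is any closed symmetric neighbourhood of the diagonal such that $(f^n(y),f^n(z))\in U$ for all $n\in\mathbb Z$ only if $y=z$ (the topology does not depend on $U$). The internal topology of $W_-(x)$ is defined in the same way with $f^{-1}$ in place of $f$. A *splitting* of $(\mathcal X,f)$ is a (surjective) covering map $\pi:\mathcal M\to\mathcal X$, where $\mathcal M$ has a global direct product structure, such that $\pi$ preserves the local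 product structures and, for every $m\in\mathcal M$, restricts to homeomorphisms $P_1(\mathcal M,m)\to W_+(\pi(m))$ and $P_2(\mathcal M,m)\to W_-(\pi(m))$, the leaves having their internal topologies. Its *group of deck transformations* is the group of all homeomorphisms $g$ of $\mathcal M$ that preserve $[\cdot,\cdot]$ and satisfy $\pi\circ g=\pi$. A *lift* of $f$ is a homeomorphism $F$ of $\mathcal M$ that preserves $[\cdot,\cdot]$ and satisfies $\pi\circ F=f\circ\pi$. **Theorem.** For $i=1,2$, let $(\mathcal X_i,f_i)$ be a connected and locally connected Smale space, $\pi_i:\mathcal M_i\to\mathcal X_i$ a splitting of it with group of deck transformations $G_i$, and $F_i:\mathcal M_i\to\mathcal M_i$ a lift of $f_i$ that has a fixed point. Suppose that there exist an isomorphism $\psi:G_1\to G_2$ and a continuous map $\Phi:\mathcal M_1\to\mathcal M_2$ such that $$\Phi(g(x))=\psi(g)(\Phi(x))\quad\text{and}\quad\Phi(F_1(x))=F_2(\Phi(x))\qquad\text{for all }x\in\mathcal M_1,\ g\in G_1.$$ Then $(\mathcal X_1,f_1)$ and $(\mathcal X_2,f_2)$ are topologically conjugate: there is a homeomorphism $h:\mathcal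 X_1\to\mathcal X_2$ with $h\circ f_1=f_2\circ h$. -/

import Mathlib

open Set Filter Topology

namespace Smale

universe u v

/-- A (global) direct product structure on `M`: a continuous `[·,·] : M × M → M` with
`[x,x] = x`, `[[x,y],z] = [x,z]` and `[x,[y,z]] = [x,z]`. -/
structure DirectProduct (M : Type u) [TopologicalSpace M] where
  br : M → M → M
  continuous_br : Continuous fun p : M × M => br p.1 p.2
  br_self : ∀ x, br x x = x
  br_left : ∀ x y z, br (br x y) z = br x z
  br_right : ∀ x y z, br x (br y z) = br x z

/-- An open subset of `X` equipped with a direct product structure. Only the values of `br` on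
`carrier × carrier` are meaningful; nothing below looks at the other values. -/
structure OpenRectangle (X : Type u) [TopologicalSpace X] where
  carrier : Set X
  isOpen : IsOpen carrier
  br : X → X → X
  br_mem : ∀ x ∈ carrier, ∀ y ∈ carrier, br x y ∈ carrier
  continuousOn_br : ContinuousOn (fun p : X × X => br p.1 p.2) (carrier ×ˢ carrier)
  br_self : ∀ x ∈ carrier, br x x = x
  br_left : ∀ x ∈ carrier, ∀ y ∈ carrier, ∀ z ∈ carrier, br (br x y) z = br x z
  br_right : ∀ x ∈ carrier, ∀ y ∈ carrier, ∀ z ∈ carrier, br x (br y z) = br x z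

namespace OpenRectangle

variable {X : Type u} [TopologicalSpace X]

/-- The first (stable) plaque `P₁(R, x) = {y ∈ R : [x, y] = x}`. -/
def plaque₁ (R : OpenRectangle X) (x : X) : Set X := {y | y ∈ R.carrier ∧ R.br x y = x}

/-- The second (unstable) plaque `P₂(R, x) = {y ∈ R : [x, y] = y}`. -/
def plaque₂ (R : OpenRectangle X) (x : X) : Set X := {y | y ∈ R.carrier ∧ R.br x y = y}

/-- Every point of the space has a neighbourhood on which the two products agree. -/
def Compatible (R S : OpenRectangle X) : Prop :=
  ∀ x : X, ∃ U ∈ 𝓝 x, ∀ y ∈ U ∩ R.carrier ∩ S.carrier, ∀ z ∈ U ∩ R.carrier ∩ S.carrier,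
    R.br y z = S.br y z

end OpenRectangle

/-- A local product structure, given by a covering by pairwise compatible open rectangles. -/
structure LocalProduct (X : Type u) [TopologicalSpace X] where
  atlas : Set (OpenRectangle X)
  covers : ∀ x : X, ∃ R ∈ atlas, x ∈ R.carrier
  compatible : ∀ R ∈ atlas, ∀ S ∈ atlas, R.Compatible S

/-- `R` is a rectangle of the local product structure `L`: adding it to the covering which
defines `L` preserves compatibility. -/
def LocalProduct.IsRectangle {X : Type u} [TopologicalSpace X] (L : LocalProduct X)
    (R : OpenRectangle X) : Prop :=
  ∀ S ∈ L.atlas, R.Compatible S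

/-- A continuous map preserves the local product structures if every point has a rectangular
neighbourhood `R` whose image is a rectangle `S`, with `φ [y, z]_R = [φ y, φ z]_S`. -/
def PreservesLocalProduct {X : Type u} {Y : Type v} [TopologicalSpace X] [TopologicalSpace Y]
    (L : LocalProduct X) (L' : LocalProduct Y) (φ : X → Y) : Prop :=
  Continuous φ ∧ ∀ x : X, ∃ R : OpenRectangle X, L.IsRectangle R ∧ x ∈ R.carrier ∧
    ∃ S : OpenRectangle Y, L'.IsRectangle S ∧ S.carrier = φ '' R.carrier ∧
      ∀ y ∈ R.carrier, ∀ z ∈ R.carrier, φ (R.br y z) = S.br (φ y) (φ z)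

namespace DirectProduct

variable {M : Type u} [TopologicalSpace M]

/-- The whole space as a rectangle. -/
def toOpenRectangle (D : DirectProduct M) : OpenRectangle M where
  carrier := univ
  isOpen := isOpen_univ
  br := D.br
  br_mem := fun _ _ _ _ => mem_univ _
  continuousOn_br := D.continuous_br.continuousOn
  br_self := fun x _ => D.br_self x
  br_left := fun x _ y _ z _ => D.br_left x y z
  br_right := fun x _ y _ z _ => D.br_right x y z

/-- The local product structure defined by a global one. -/
def toLocalProduct (D : DirectProduct M) : LocalProduct M where
  atlas := {D.toOpenRectangle}
  covers := fun x => ⟨D.toOpenRectangle, rfl, mem_univ x⟩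
  compatible := by
    rintro R rfl S rfl x
    exact ⟨univ, univ_mem, fun _ _ _ _ => rfl⟩

/-- The plaque `P₁(M, x) = {y : [x, y] = x}`. -/
def plaque₁ (D : DirectProduct M) (x : M) : Set M := {y | D.br x y = x}

/-- The plaque `P₂(M, x) = {y : [x, y] = y}`. -/
def plaque₂ (D : DirectProduct M) (x : M) : Set M := {y | D.br x y = y}

end DirectProduct

section Dynamics

variable {X : Type u} [TopologicalSpace X]

/-- `(X, f)`, with the local product structure `L`, is a Smale space: `X` is compact, `f`
preserves `L`, and for some metric `m` defining the topology of `X` and constants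
`0 < lam < 1`, `C > 0`, every point has a rectangular neighbourhood `R` such that `f` contracts
the first plaques of `R` and `f⁻¹` contracts the second plaques of `R`. -/
structure IsSmaleSpace (L : LocalProduct X) (f : X ≃ₜ X) : Prop where
  compact : CompactSpace X
  preserves : PreservesLocalProduct L L f
  contracts : ∃ m : MetricSpace X,
    m.toUniformSpace.toTopologicalSpace = ‹TopologicalSpace X› ∧
    ∃ lam C : ℝ, 0 < lam ∧ lam < 1 ∧ 0 < C ∧
      ∀ p : X, ∃ R : OpenRectangle X, L.IsRectangle R ∧ p ∈ R.carrier ∧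
        ∀ x ∈ R.carrier,
          (∀ n : ℕ, ∀ y ∈ R.plaque₁ x, ∀ z ∈ R.plaque₁ x,
            m.dist (f^[n] y) (f^[n] z) ≤ C * lam ^ n * m.dist y z) ∧
          (∀ n : ℕ, ∀ y ∈ R.plaque₂ x, ∀ z ∈ R.plaque₂ x,
            m.dist (f.symm^[n] y) (f.symm^[n] z) ≤ C * lam ^ n * m.dist y z)

/-- The stable leaf of `x`: all `y` such that the pair `(fⁿ x, fⁿ y)` converges to the diagonal
as `n → ∞` (for compact metrizable `X`: such that `d(fⁿ x, fⁿ y) → 0`). The unstable leaf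
of `x` is `leaf f.symm x`. -/
def leaf (f : X ≃ₜ X) (x : X) : Set X :=
  {y | Tendsto (fun n : ℕ => (f^[n] x, f^[n] y)) atTop (𝓝ˢ (diagonal X))}

/-- A closed symmetric neighbourhood `U` of the diagonal witnessing expansivity of `f`. -/
structure IsExpansiveNhd (f : X ≃ₜ X) (U : Set (X × X)) : Prop where
  mem_nhdsSet : U ∈ 𝓝ˢ (diagonal X)
  isClosed : IsClosed U
  symm : ∀ x y, (x, y) ∈ U → (y, x) ∈ U
  expansive : ∀ x y, (∀ n : ℤ, ((f ^ n) x, (f ^ n) y) ∈ U) → x = y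

/-- The ball `{y : ℓ₊(x, y) ≥ n}` of the internal log-scale `ℓ₊` defined by `U`, where
`ℓ₊(x, y)` is the largest `n` with `(fᵏ x, fᵏ y) ∈ U` for all `k ≥ -n`. -/
def logBall (f : X ≃ₜ X) (U : Set (X × X)) (n : ℤ) (x : X) : Set X :=
  {y | ∀ k : ℤ, -n ≤ k → ((f ^ k) x, (f ^ k) y) ∈ U}

/-- The internal topology of the leaf of `x`, defined by the log-scale `ℓ₊`: a set is open iff
with each of its points it contains a log-scale ball of the leaf about this point. -/
abbrev leafTopology (f : X ≃ₜ X) (U : Set (X × X)) (x : X) : TopologicalSpace (leaf f x) where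
  IsOpen O := ∀ y ∈ O, ∃ n : ℤ, ∀ z : leaf f x, (z : X) ∈ logBall f U n y → z ∈ O
  isOpen_univ := fun _ _ => ⟨0, fun _ _ => mem_univ _⟩
  isOpen_inter := by
    intro s t hs ht y hy
    obtain ⟨a, ha⟩ := hs y hy.1
    obtain ⟨b, hb⟩ := ht y hy.2
    refine ⟨max a b, fun z hz => ⟨ha z fun k hk => hz k ?_, hb z fun k hk => hz k ?_⟩⟩
    · exact le_trans (neg_le_neg (le_max_left a b)) hk
    · exact le_trans (neg_le_neg (le_max_right a b)) hk
  isOpen_sUnion := by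
    intro S hS y hy
    obtain ⟨s, hs, hys⟩ := hy
    obtain ⟨n, hn⟩ := hS s hs y hys
    exact ⟨n, fun z hz => ⟨s, hs, hn z hz⟩⟩

end Dynamics

section Splitting

variable {X : Type u} [TopologicalSpace X] {M : Type v} [TopologicalSpace M]

/-- `π` restricts to a homeomorphism from the set `P ⊆ M` onto the leaf of `x`, the latter
with its internal topology (which does not depend on the neighbourhood `U`). -/
def IsHomeomorphOntoLeaf (f : X ≃ₜ X) (π : M → X) (P : Set M) (x : X) : Prop :=
  ∃ h : MapsTo π P (leaf f x), ∀ U : Set (X × X), IsExpansiveNhd f U →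
    @IsHomeomorph P (leaf f x) inferInstance (leafTopology f U x) (h.restrict π P (leaf f x))

/-- `π : M → X` is a splitting of the Smale space `(X, f)`, where `M` carries the direct product
structure `D`. -/
structure IsSplitting (L : LocalProduct X) (f : X ≃ₜ X) (D : DirectProduct M) (π : M → X) :
    Prop where
  isCoveringMap : IsCoveringMap π
  surjective : Function.Surjective π
  preserves : PreservesLocalProduct D.toLocalProduct L π
  stable : ∀ m : M, IsHomeomorphOntoLeaf f π (D.plaque₁ m) (π m)
  unstable : ∀ m : M, IsHomeomorphOntoLeaf f.symm π (D.plaque₂ m) (π m)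

/-- The group of deck transformations of a splitting: the homeomorphisms `g` of `M` which
preserve the direct product structure and satisfy `π ∘ g = π`. -/
def deckGroup (D : DirectProduct M) (π : M → X) : Subgroup (M ≃ₜ M) where
  carrier := {g | (∀ x y, g (D.br x y) = D.br (g x) (g y)) ∧ ∀ x, π (g x) = π x}
  one_mem' := ⟨fun _ _ => rfl, fun _ => rfl⟩
  mul_mem' := by
    rintro a b ⟨ha, ha'⟩ ⟨hb, hb'⟩
    refine ⟨fun x y => ?_, fun x => ?_⟩
    · change a (b _) = D.br (a (b x)) (a (b y))
      rw [hb, ha]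
    · change π (a (b x)) = π x
      rw [ha', hb']
  inv_mem' := by
    rintro a ⟨ha, ha'⟩
    refine ⟨fun x y => ?_, fun x => ?_⟩
    · change a.symm _ = D.br (a.symm x) (a.symm y)
      apply a.injective
      rw [ha]
      simp
    · change π (a.symm x) = π x
      rw [← ha' (a.symm x)]
      simp

/-- `F` is a lift of `f`: a homeomorphism of `M` preserving the direct product structure, with
`π ∘ F = f ∘ π`. -/
structure IsLift (f : X ≃ₜ X) (D : DirectProduct M) (π : M → X) (F : M ≃ₜ M) : Prop where
  map_br : ∀ x y, F (D.br x y) = D.br (F x) (F y)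
  comm : ∀ x, π (F x) = f (π x)

end Splitting

/-- Topological conjugacy of `(X, f)` and `(Y, g)`. -/
def TopConjugate {X : Type u} {Y : Type v} [TopologicalSpace X] [TopologicalSpace Y]
    (f : X ≃ₜ X) (g : Y ≃ₜ Y) : Prop :=
  ∃ h : X ≃ₜ Y, ∀ x, h (f x) = g (h x)

end Smale

/-!
The map `Φ` induces a continuous map `h : X₁ → X₂` with `h ∘ π₁ = π₂ ∘ Φ` and `h ∘ f₁ = f₂ ∘ h`,
because the fibres of a splitting are the orbits of its deck group (`exists_deck`). As `X₁` is
compact and `X₂` is Hausdorff, it remains to see that `h` is bijective.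

*Hyperbolicity upstairs.* In a Smale space, points whose forward orbits stay close lie in a common
local stable plaque (`IsSmaleSpace.exists_forward_close`); hence `f` is expansive, so that the
homeomorphisms between plaques of `M` and leaves are available. Over a small connected rectangle
the sections of `π` preserve the products (`IsSectionOn.map_br`). It follows that two points of a
stable plaque of `M` are moved by high powers of `F` into one sheet over such a rectangle
(`eventually_exists_section`), so that `M` is connected, and that the contraction is uniform for
pairs of points that are at bounded distance, i.e. lie in a compact subset of `M × M` modulo deck
transformations (`eventually_close`).

*Deck transformations.* Let `π m = π m'`. The leaf homeomorphisms identify the plaques of `m` with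
those of `m'`, and their product is a homeomorphism of `M`. It commutes with `π`: for `α` in the
stable plaque of `m` this is an open and closed condition on the unstable coordinate `β`, since
`Fⁿ` makes the strip between `β` and `[α, β]` so thin that it lies in one sheet (`proj_br_eq`).
The action is cocompact and properly discontinuous.

*The map `Φ`.* It maps plaques into plaques and thus preserves the products (`map_br`). It is
injective: if `Φ a = Φ b`, then the pairs `(Fᵏ a, Fᵏ b)`, `k ∈ ℤ`, are all at bounded distance,
because `Φ` is equivariant with respect to an isomorphism; if moreover `a` and `b` lie in one
plaque, then uniform contraction and expansivity give `a = b`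
(`eq_of_stable_plaque_of_map_eq`). The image of `h` is everything: for `y` in the stable plaque of
`Φ x₀`, cocompactness provides points of the form `[Φ xₙ, F⁻ⁿ y]` at bounded distance from
`F⁻ⁿ y`, and applying `Fⁿ` gives points of the image of `Φ` whose projections converge to that of
`y` (`proj_mem_range_of_stable_plaque`).

Statements are proved for stable plaques only; those for unstable plaques follow by passing to the
opposite products `(x, y) ↦ [y, x]` and to the inverse homeomorphisms.
-/

namespace Smale

variable {X Y M : Type*} [TopologicalSpace X] [TopologicalSpace Y] [TopologicalSpace M]

/-! ### Duality -/

/-- The opposite rectangle, with product `(x, y) ↦ [y, x]`; it exchanges the two kinds of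
plaques. -/
def OpenRectangle.op (R : OpenRectangle X) : OpenRectangle X where
  carrier := R.carrier
  isOpen := R.isOpen
  br x y := R.br y x
  br_mem x hx y hy := R.br_mem y hy x hx
  continuousOn_br := R.continuousOn_br.comp continuous_swap.continuousOn fun _ hp => ⟨hp.2, hp.1⟩
  br_self := R.br_self
  br_left x hx y hy z hz := R.br_right z hz y hy x hx
  br_right x hx y hy z hz := R.br_left z hz y hy x hx

/-- The opposite of a global direct product structure. -/
def DirectProduct.op (D : DirectProduct M) : DirectProduct M where
  br x y := D.br y x
  continuous_br := D.continuous_br.comp continuous_swap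
  br_self := D.br_self
  br_left x y z := D.br_right z y x
  br_right x y z := D.br_left z y x

theorem OpenRectangle.Compatible.op {R S : OpenRectangle X} (h : R.Compatible S) :
    R.op.Compatible S.op := fun x => by
  obtain ⟨U, hU, h⟩ := h x
  exact ⟨U, hU, fun y hy z hz => h z hz y hy⟩

/-- The opposite local product structure. -/
def LocalProduct.op (L : LocalProduct X) : LocalProduct X where
  atlas := {R | R.op ∈ L.atlas}
  covers x := by
    obtain ⟨R, hR, hx⟩ := L.covers x
    exact ⟨R.op, hR, hx⟩
  compatible R hR S hS := (L.compatible _ hR _ hS).op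

theorem LocalProduct.IsRectangle.op {L : LocalProduct X} {R : OpenRectangle X}
    (h : L.IsRectangle R) : L.op.IsRectangle R.op := fun S hS => (h S.op hS).op

theorem OpenRectangle.br_eq_left_iff (R : OpenRectangle X) {x y : X} (hx : x ∈ R.carrier)
    (hy : y ∈ R.carrier) : R.br x y = x ↔ R.br y x = y := by
  constructor
  · intro h
    rw [← h, R.br_right y hy x hx y hy, R.br_self y hy]
  · intro h
    rw [← h, R.br_right x hx y hy x hx, R.br_self x hx]

theorem OpenRectangle.br_eq_right_iff (R : OpenRectangle X) {x y : X} (hx : x ∈ R.carrier)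
    (hy : y ∈ R.carrier) : R.br x y = y ↔ R.br y x = x :=
  R.op.br_eq_left_iff hy hx

theorem OpenRectangle.op_plaque₁ (R : OpenRectangle X) {x : X} (hx : x ∈ R.carrier) :
    R.op.plaque₁ x = R.plaque₂ x := by
  ext y
  exact and_congr_right fun hy => (R.br_eq_right_iff hx hy).symm

theorem OpenRectangle.op_plaque₂ (R : OpenRectangle X) {x : X} (hx : x ∈ R.carrier) :
    R.op.plaque₂ x = R.plaque₁ x := by
  ext y
  exact and_congr_right fun hy => (R.br_eq_left_iff hx hy).symm

namespace DirectProduct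

theorem br_eq_left_iff (D : DirectProduct M) {x y : M} : D.br x y = x ↔ D.br y x = y :=
  D.toOpenRectangle.br_eq_left_iff (mem_univ x) (mem_univ y)

theorem br_eq_right_iff (D : DirectProduct M) {x y : M} : D.br x y = y ↔ D.br y x = x :=
  D.toOpenRectangle.br_eq_right_iff (mem_univ x) (mem_univ y)

theorem op_plaque₁ (D : DirectProduct M) (x : M) : D.op.plaque₁ x = D.plaque₂ x := by
  ext y
  exact D.br_eq_right_iff.symm

theorem op_plaque₂ (D : DirectProduct M) (x : M) : D.op.plaque₂ x = D.plaque₁ x := by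
  ext y
  exact D.br_eq_left_iff.symm

theorem continuous_br' (D : DirectProduct M) {T : Type*} [TopologicalSpace T] {u v : T → M}
    (hu : Continuous u) (hv : Continuous v) : Continuous fun t => D.br (u t) (v t) :=
  D.continuous_br.comp (hu.prodMk hv)

theorem toLocalProduct_isRectangle (D : DirectProduct M) :
    D.toLocalProduct.IsRectangle D.toOpenRectangle := by
  rintro S rfl x
  exact ⟨univ, univ_mem, fun _ _ _ _ => rfl⟩

end DirectProduct

theorem PreservesLocalProduct.op {L : LocalProduct X} {L' : LocalProduct Y} {φ : X → Y}
    (h : PreservesLocalProduct L L' φ) : PreservesLocalProduct L.op L'.op φ := by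
  refine ⟨h.1, fun x => ?_⟩
  obtain ⟨R, hR, hx, S, hS, hRS, hbr⟩ := h.2 x
  exact ⟨R.op, hR.op, hx, S.op, hS.op, hRS, fun y hy z hz => hbr z hz y hy⟩

theorem PreservesLocalProduct.symm {L : LocalProduct X} {L' : LocalProduct Y} {φ : X ≃ₜ Y}
    (h : PreservesLocalProduct L L' φ) : PreservesLocalProduct L' L φ.symm := by
  refine ⟨φ.symm.continuous, fun y => ?_⟩
  obtain ⟨R, hR, hx, S, hS, hRS, hbr⟩ := h.2 (φ.symm y)
  refine ⟨S, hS, by rw [hRS]; exact ⟨_, hx, by simp⟩, R, hR, by simp [hRS, image_image], ?_⟩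
  rw [hRS]
  rintro _ ⟨u, hu, rfl⟩ _ ⟨v, hv, rfl⟩
  rw [← hbr u hu v hv]
  simp

theorem IsSmaleSpace.op {L : LocalProduct X} {f : X ≃ₜ X} (h : IsSmaleSpace L f) :
    IsSmaleSpace L.op f.symm := by
  obtain ⟨m, hm, lam, C, h0, h1, hC, hR⟩ := h.contracts
  refine ⟨h.compact, h.preserves.symm.op, m, hm, lam, C, h0, h1, hC, fun p => ?_⟩
  obtain ⟨R, hRr, hp, hc⟩ := hR p
  refine ⟨R.op, hRr.op, hp, fun x hx => ?_⟩
  rw [R.op_plaque₁ hx, R.op_plaque₂ hx]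
  exact ⟨(hc x hx).2, (hc x hx).1⟩

theorem IsSplitting.op {L : LocalProduct X} {f : X ≃ₜ X} {D : DirectProduct M} {π : M → X}
    (h : IsSplitting L f D π) : IsSplitting L.op f.symm D.op π := by
  refine ⟨h.isCoveringMap, h.surjective, ?_, fun m => ?_, fun m => ?_⟩
  · refine ⟨h.preserves.1, fun x => ?_⟩
    obtain ⟨R, hR, hx, S, hS, hRS, hbr⟩ := h.preserves.2 x
    refine ⟨R.op, ?_, hx, S.op, hS.op, hRS, fun y hy z hz => hbr z hz y hy⟩
    rintro T rfl
    exact (hR _ rfl).op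
  · rw [D.op_plaque₁]
    exact h.unstable m
  · rw [D.op_plaque₂]
    exact h.stable m

theorem IsLift.op {f : X ≃ₜ X} {D : DirectProduct M} {π : M → X} {F : M ≃ₜ M}
    (h : IsLift f D π F) : IsLift f.symm D.op π F.symm := by
  refine ⟨fun x y => ?_, fun x => ?_⟩
  · change F.symm (D.br y x) = D.br (F.symm y) (F.symm x)
    apply F.injective
    simp [h.map_br]
  · apply f.injective
    simp [← h.comm]

theorem mem_deckGroup_op {Z : Type*} {D : DirectProduct M} {π : M → Z} {g : M ≃ₜ M} :
    g ∈ deckGroup D.op π ↔ g ∈ deckGroup D π :=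
  and_congr_left fun _ => ⟨fun h x y => h y x, fun h x y => h y x⟩

/-! ### The bracket near the diagonal -/

theorem OpenRectangle.continuousAt_br (R : OpenRectangle X) {x y : X} (hx : x ∈ R.carrier)
    (hy : y ∈ R.carrier) : ContinuousAt (fun p : X × X => R.br p.1 p.2) (x, y) :=
  R.continuousOn_br.continuousAt ((R.isOpen.prod R.isOpen).mem_nhds ⟨hx, hy⟩)

theorem LocalProduct.IsRectangle.eventually_br_eq {L : LocalProduct X} {R S : OpenRectangle X}
    (hR : L.IsRectangle R) (hS : L.IsRectangle S) {x : X} (hxR : x ∈ R.carrier)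
    (hxS : x ∈ S.carrier) : ∀ᶠ p in 𝓝 (x, x), R.br p.1 p.2 = S.br p.1 p.2 := by
  obtain ⟨T, hT, hxT⟩ := L.covers x
  obtain ⟨U, hU, h⟩ := hR T hT x
  obtain ⟨U', hU', h'⟩ := hS T hT x
  have hN : (U ∩ R.carrier ∩ T.carrier) ∩ (U' ∩ S.carrier ∩ T.carrier) ∈ 𝓝 x :=
    inter_mem (inter_mem (inter_mem hU (R.isOpen.mem_nhds hxR)) (T.isOpen.mem_nhds hxT))
      (inter_mem (inter_mem hU' (S.isOpen.mem_nhds hxS)) (T.isOpen.mem_nhds hxT))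
  filter_upwards [prod_mem_nhds hN hN] with p hp
  rw [h _ hp.1.1 _ hp.2.1, h' _ hp.1.2 _ hp.2.2]

theorem PreservesLocalProduct.eventually_map_br {L : LocalProduct X} {L' : LocalProduct Y}
    {φ : X → Y} (h : PreservesLocalProduct L L' φ) {R : OpenRectangle X} {S : OpenRectangle Y}
    (hR : L.IsRectangle R) (hS : L'.IsRectangle S) {x : X} (hxR : x ∈ R.carrier)
    (hxS : φ x ∈ S.carrier) :
    ∀ᶠ p in 𝓝 (x, x), φ (R.br p.1 p.2) = S.br (φ p.1) (φ p.2) := by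
  obtain ⟨R', hR', hx', S', hS', hRS, hbr⟩ := h.2 x
  have hxS' : φ x ∈ S'.carrier := hRS ▸ mem_image_of_mem φ hx'
  have ht : Tendsto (Prod.map φ φ) (𝓝 (x, x)) (𝓝 (φ x, φ x)) :=
    (h.1.prodMap h.1).tendsto (x, x)
  filter_upwards [hR.eventually_br_eq hR' hxR hx', ht (hS.eventually_br_eq hS' hxS hxS'),
    prod_mem_nhds (R'.isOpen.mem_nhds hx') (R'.isOpen.mem_nhds hx')] with p h₁ h₂ h₃
  rw [h₁, hbr _ h₃.1 _ h₃.2]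
  exact h₂.symm

/-- `β` is a globally defined function that agrees near each point of the diagonal with the
products of the rectangles around this point. Its values far from the diagonal are irrelevant. -/
def LocalProduct.IsBracket (L : LocalProduct X) (β : X → X → X) : Prop :=
  ∀ (x : X) (R : OpenRectangle X), L.IsRectangle R → x ∈ R.carrier →
    ∀ᶠ p in 𝓝 (x, x), β p.1 p.2 = R.br p.1 p.2

theorem LocalProduct.IsBracket.op {L : LocalProduct X} {β : X → X → X} (h : L.IsBracket β) :
    L.op.IsBracket fun x y => β y x := by
  intro x R hR hx
  exact (continuous_swap.tendsto (x, x)) (h x R.op (fun S hS => (hR S.op hS).op) hx)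

theorem LocalProduct.exists_isBracket [CompactSpace X] [T2Space X] (L : LocalProduct X) :
    ∃ β, L.IsBracket β := by
  classical
  choose R hR hxR using L.covers
  have hRr : ∀ p, L.IsRectangle (R p) := fun p => L.compatible _ (hR p)
  have hC : ∀ p, ∃ C ∈ 𝓝 p, IsClosed C ∧ C ⊆ (R p).carrier := fun p =>
    exists_mem_nhds_isClosed_subset ((R p).isOpen.mem_nhds (hxR p))
  choose C hCn hCc hCR using hC
  obtain ⟨t, ht⟩ := isCompact_univ.elim_finite_subcover (fun p => interior (C p))
    (fun p => isOpen_interior) fun p _ => mem_iUnion.2 ⟨p, mem_interior_iff_mem_nhds.2 (hCn p)⟩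
  refine ⟨fun x y => if h : ∃ p ∈ t, x ∈ C p ∧ y ∈ C p then (R h.choose).br x y else x,
    fun x S hS hx => ?_⟩
  -- Only the closed sets `C p` containing `x` matter near `x`, and there `R p` is defined at `x`.
  have h₁ : ∀ᶠ q : X × X in 𝓝 (x, x), ∀ p ∈ t, q.1 ∈ C p → (R p).br q.1 q.2 = S.br q.1 q.2 := by
    rw [Filter.eventually_all_finset]
    intro p _
    by_cases hp : x ∈ C p
    · filter_upwards [(hRr p).eventually_br_eq hS (hCR p hp) hx] with q hq _ using hq
    · filter_upwards [continuous_fst.tendsto (x, x) ((hCc p).isOpen_compl.mem_nhds hp)]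
        with q hq h using (hq h).elim
  obtain ⟨p, hp⟩ := mem_iUnion.1 (ht (mem_univ x))
  obtain ⟨hpt, hp⟩ := mem_iUnion.1 hp
  have hn := mem_interior_iff_mem_nhds.1 hp
  filter_upwards [h₁, prod_mem_nhds hn hn] with q hq hq'
  have h : ∃ p ∈ t, q.1 ∈ C p ∧ q.2 ∈ C p := ⟨p, hpt, hq'.1, hq'.2⟩
  simp only [dif_pos h]
  exact hq _ h.choose_spec.1 h.choose_spec.2.1

/-! ### Local stable sets and expansivity -/

theorem zpow_natCast_apply (f : X ≃ₜ X) (n : ℕ) (x : X) : (f ^ (n : ℤ)) x = f^[n] x := by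
  rw [zpow_natCast]
  induction n generalizing x with
  | zero => rfl
  | succ n ih => rw [pow_succ, Function.iterate_succ_apply, ← ih]; rfl

theorem zpow_neg_natCast_apply (f : X ≃ₜ X) (n : ℕ) (x : X) :
    (f ^ (-(n : ℤ))) x = f.symm^[n] x := by
  rw [← zpow_natCast_apply, zpow_neg, ← inv_zpow]; rfl

theorem zpow_add_apply (f : X ≃ₜ X) (i j : ℤ) (x : X) : (f ^ (i + j)) x = (f ^ i) ((f ^ j) x) := by
  rw [zpow_add]; rfl

namespace IsSmaleSpace

variable {L : LocalProduct X} {f : X ≃ₜ X}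

theorem t2Space (h : IsSmaleSpace L f) : T2Space X := by
  obtain ⟨m, hm, -⟩ := h.contracts
  subst hm
  infer_instance

/-- In a Smale space two points whose forward orbits stay close lie in a common local stable
plaque. Indeed, the points `[fᵏ x, fᵏ y] = fᵏ [x, y]` lie in the unstable plaques of `fᵏ x`, so
applying `f⁻ᵏ` gives `d([x, y], x) ≤ C λᵏ diam X` for all `k`. -/
theorem exists_forward_close (h : IsSmaleSpace L f) {β : X → X → X} (hβ : L.IsBracket β) :
    ∃ V ∈ 𝓝ˢ (diagonal X), ∀ x y, (∀ k : ℕ, (f^[k] x, f^[k] y) ∈ V) → β x y = x := by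
  have := h.compact
  obtain ⟨m, hm, lam, C, h0, h1, hC, hR⟩ := h.contracts
  subst hm
  refine ⟨{q | (∀ n : ℕ, m.dist (f.symm^[n] (β q.1 q.2)) (f.symm^[n] q.1) ≤
    C * lam ^ n * m.dist (β q.1 q.2) q.1) ∧ f (β q.1 q.2) = β (f q.1) (f q.2)}, ?_, ?_⟩
  · rw [mem_nhdsSet_iff_forall]
    rintro ⟨p, q⟩ hpq
    obtain rfl : p = q := hpq
    obtain ⟨R, hRr, hp, hc⟩ := hR p
    obtain ⟨S, hS, hfp, -⟩ := hR (f p)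
    have ht : Tendsto (Prod.map f f) (𝓝 (p, p)) (𝓝 (f p, f p)) :=
      (f.continuous.prodMap f.continuous).tendsto (p, p)
    have hn := R.isOpen.mem_nhds hp
    filter_upwards [hβ p R hRr hp, h.preserves.eventually_map_br hRr hS hp hfp,
      ht (hβ (f p) S hS hfp), prod_mem_nhds hn hn] with q h₁ h₂ h₃ h₄
    refine ⟨fun n => ?_, ?_⟩
    · rw [h₁]
      exact (hc q.1 h₄.1).2 n _ ⟨R.br_mem _ h₄.1 _ h₄.2, R.br_right _ h₄.1 _ h₄.1 _ h₄.2⟩ _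
        ⟨h₄.1, R.br_self _ h₄.1⟩
    · rw [h₁, h₂]
      exact h₃.symm
  · intro x y hxy
    have hk : ∀ k : ℕ, f^[k] (β x y) = β (f^[k] x) (f^[k] y) := by
      intro k
      induction k with
      | zero => rfl
      | succ k ih => simp only [Function.iterate_succ_apply', ih, (hxy k).2]
    have hle : ∀ k : ℕ, dist (β x y) x ≤ C * lam ^ k * Metric.diam (univ : Set X) := by
      intro k
      have h₁ := (hxy k).1 k
      simp only [← hk] at h₁
      have hl : Function.LeftInverse f.symm^[k] f^[k] :=
        Function.LeftInverse.iterate f.symm_apply_apply k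
      rw [hl, hl] at h₁
      refine h₁.trans (mul_le_mul_of_nonneg_left ?_ (by positivity))
      exact Metric.dist_le_diam_of_mem isCompact_univ.isBounded (mem_univ _) (mem_univ _)
    have hlim : Tendsto (fun k : ℕ => C * lam ^ k * Metric.diam (univ : Set X)) atTop (𝓝 0) := by
      simpa using ((tendsto_pow_atTop_nhds_zero_of_lt_one h0.le h1).const_mul C).mul_const
        (Metric.diam (univ : Set X))
    exact dist_le_zero.1 (ge_of_tendsto' hlim hle)

theorem exists_isExpansiveNhd (h : IsSmaleSpace L f) : ∃ U, IsExpansiveNhd f U := by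
  have := h.compact
  have := h.t2Space
  obtain ⟨β, hβ⟩ := L.exists_isBracket
  obtain ⟨V, hV, hVβ⟩ := h.exists_forward_close hβ
  obtain ⟨V', hV', hVβ'⟩ := h.op.exists_forward_close hβ.op
  have hW : {q : X × X | β q.1 q.2 = q.1 → β q.2 q.1 = q.1 → q.1 = q.2} ∈ 𝓝ˢ (diagonal X) := by
    rw [mem_nhdsSet_iff_forall]
    rintro ⟨p, q⟩ hpq
    obtain rfl : p = q := hpq
    obtain ⟨R, hR, hp⟩ := L.covers p
    have hRr : L.IsRectangle R := L.compatible R hR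
    have hn := R.isOpen.mem_nhds hp
    filter_upwards [hβ p R hRr hp, (continuous_swap.tendsto (p, p)) (hβ p R hRr hp),
      prod_mem_nhds hn hn] with q h₁ h₂ h₃ h₄ h₅
    rw [h₁] at h₄
    change β q.2 q.1 = R.br q.2 q.1 at h₂
    rw [h₂] at h₅
    rw [← h₄, (R.br_eq_right_iff h₃.1 h₃.2).2 h₅]
  let := uniformSpaceOfCompactR1 (γ := X)
  rw [nhdsSet_diagonal_eq_uniformity] at *
  obtain ⟨U, ⟨hU, hUc⟩, hUs⟩ := uniformity_hasBasis_closed.mem_iff.1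
    (inter_mem (inter_mem hV hV') hW)
  refine ⟨U ∩ Prod.swap ⁻¹' U, ?_, hUc.inter (hUc.preimage continuous_swap),
    fun x y hxy => ⟨hxy.2, hxy.1⟩, fun x y hxy => ?_⟩
  · rw [nhdsSet_diagonal_eq_uniformity]
    exact inter_mem hU (tendsto_swap_uniformity hU)
  · refine (hUs (hxy 0).1).2 (hVβ x y fun k => ?_) (hVβ' x y fun k => ?_)
    · rw [← zpow_natCast_apply, ← zpow_natCast_apply]
      exact (hUs (hxy k).1).1.1
    · rw [← zpow_neg_natCast_apply, ← zpow_neg_natCast_apply]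
      exact (hUs (hxy (-k)).1).1.2

/-- The stable plaques of a small rectangle are contracted uniformly. -/
theorem exists_contracting (h : IsSmaleSpace L f) (p : X) :
    ∃ R : OpenRectangle X, L.IsRectangle R ∧ p ∈ R.carrier ∧ ∀ V ∈ 𝓝ˢ (diagonal X),
      ∀ᶠ n : ℕ in atTop, ∀ x ∈ R.carrier, ∀ y ∈ R.carrier, R.br x y = x →
        (f^[n] x, f^[n] y) ∈ V := by
  have := h.compact
  obtain ⟨m, hm, lam, C, h0, h1, hC, hR⟩ := h.contracts
  subst hm
  obtain ⟨R, hRr, hp, hc⟩ := hR p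
  refine ⟨R, hRr, hp, fun V hV => ?_⟩
  rw [nhdsSet_diagonal_eq_uniformity] at hV
  obtain ⟨ε, hε, hV⟩ := Metric.mem_uniformity_dist.1 hV
  have hlim : Tendsto (fun k : ℕ => C * lam ^ k * Metric.diam (univ : Set X)) atTop (𝓝 0) := by
    simpa using ((tendsto_pow_atTop_nhds_zero_of_lt_one h0.le h1).const_mul C).mul_const
      (Metric.diam (univ : Set X))
  filter_upwards [hlim.eventually_lt_const hε] with n hn x hx y hy hxy
  refine hV (lt_of_le_of_lt ?_ hn)
  refine ((hc x hx).1 n x ⟨hx, R.br_self x hx⟩ y ⟨hy, hxy⟩).trans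
    (mul_le_mul_of_nonneg_left ?_ (by positivity))
  exact Metric.dist_le_diam_of_mem isCompact_univ.isBounded (mem_univ _) (mem_univ _)

end IsSmaleSpace

theorem IsSmaleSpace.exists_isBracket {L : LocalProduct X} {f : X ≃ₜ X}
    (h : IsSmaleSpace L f) : ∃ β, L.IsBracket β := by
  have := h.compact
  have := h.t2Space
  exact L.exists_isBracket

/-- If `y` lies on the stable leaf of `x`, then the brackets of `fⁿ x` and `fⁿ y` are eventually
those of points of a common stable plaque. -/
theorem IsSmaleSpace.eventually_bracket_eq {L : LocalProduct X} {f : X ≃ₜ X}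
    (h : IsSmaleSpace L f) {β : X → X → X} (hβ : L.IsBracket β) {x y : X} (hy : y ∈ leaf f x) :
    ∀ᶠ n : ℕ in atTop, β (f^[n] x) (f^[n] y) = f^[n] x := by
  obtain ⟨V, hV, hVβ⟩ := h.exists_forward_close hβ
  obtain ⟨N, hN⟩ := eventually_atTop.1 (hy.eventually hV)
  filter_upwards [eventually_ge_atTop N] with n hn
  refine hVβ _ _ fun k => ?_
  rw [← Function.iterate_add_apply, ← Function.iterate_add_apply]
  exact hN _ (by omega)

/-! ### Sections of the splitting over small connected rectangles -/

/-- `s` is a continuous section of `π` over `W` whose image is open. -/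
structure IsSectionOn (π : M → X) (s : X → M) (W : Set X) : Prop where
  continuousOn : ContinuousOn s W
  proj : ∀ x ∈ W, π (s x) = x
  isOpen_image : IsOpen (s '' W)

/-- A covering map has a section through each point over each small open set. -/
theorem exists_isSectionOn {π : M → X} (hπ : IsCoveringMap π) (p : X) :
    ∃ U ∈ 𝓝 p, ∀ W ⊆ U, IsOpen W → ∀ m, π m ∈ W → ∃ s, IsSectionOn π s W ∧ s (π m) = m := by
  classical
  obtain ⟨hd, U, hpU, hU, hUπ, H, hH⟩ := hπ p
  refine ⟨U, hU.mem_nhds hpU, fun W hWU hW m hm => ?_⟩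
  have hmU : m ∈ π ⁻¹' U := hWU hm
  set i := (H ⟨m, hmU⟩).2 with hi
  have hs : ∀ x : U, H.symm (x, i) = (if h : (x : X) ∈ U then (H.symm (⟨x, h⟩, i) : M) else m) :=
    fun x => by rw [dif_pos x.2]
  have hproj : ∀ x : U, π (H.symm (x, i)) = x := fun x => by rw [← hH]; simp
  refine ⟨fun x => if h : x ∈ U then (H.symm (⟨x, h⟩, i) : M) else m, ⟨?_, ?_, ?_⟩, ?_⟩
  · refine ContinuousOn.mono ?_ hWU
    rw [continuousOn_iff_continuous_domRestrict]
    have hc : Continuous fun x : U => (H.symm (x, i) : M) := by fun_prop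
    exact hc.congr hs
  · intro x hx
    rw [← hs ⟨x, hWU hx⟩, hproj]
  · have : (fun x => if h : x ∈ U then (H.symm (⟨x, h⟩, i) : M) else m) '' W =
        Subtype.val '' (H ⁻¹' {q | (q.1 : X) ∈ W ∧ q.2 = i}) := by
      ext u
      constructor
      · rintro ⟨x, hx, rfl⟩
        exact ⟨H.symm (⟨x, hWU hx⟩, i), by simpa using hx, hs ⟨x, hWU hx⟩⟩
      · rintro ⟨v, ⟨hv, hvi⟩, rfl⟩
        refine ⟨_, hv, ?_⟩
        change (if h : ((H v).1 : X) ∈ U then (H.symm (⟨(H v).1, h⟩, i) : M) else m) = v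
        rw [← hs (H v).1, ← hvi]
        simp
    rw [this]
    refine hUπ.isOpenMap_subtype_val _ (H.continuous.isOpen_preimage _ ?_)
    exact (hW.preimage (continuous_subtype_val.comp continuous_fst)).inter
      ((isOpen_discrete {i}).preimage continuous_snd)
  · have h₁ : (H ⟨m, hmU⟩).1 = ⟨π m, hmU⟩ := Subtype.ext (hH _)
    refine (hs ⟨π m, hmU⟩).symm.trans ?_
    rw [← h₁, hi]
    simp

/-- A rectangle around `p` contains arbitrarily small connected rectangles around `p`: take all
products `[c, c']` of points of a small connected neighbourhood. -/
theorem OpenRectangle.exists_preconnected_subrectangle [LocallyConnectedSpace X]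
    (R : OpenRectangle X) {p : X} (hp : p ∈ R.carrier) {O : Set X} (hO : O ∈ 𝓝 p) :
    ∃ W : OpenRectangle X, p ∈ W.carrier ∧ W.carrier ⊆ R.carrier ∩ O ∧ W.br = R.br ∧
      IsPreconnected W.carrier := by
  have hc := R.continuousAt_br hp hp
  rw [ContinuousAt, R.br_self p hp] at hc
  have hRO : R.carrier ∩ O ∈ 𝓝 p := inter_mem (R.isOpen.mem_nhds hp) hO
  obtain ⟨N, N', hNo, hpN, hN'o, hpN', hNb⟩ := mem_nhds_prod_iff'.1 (hc hRO)
  obtain ⟨A, hAN, hAo, hpA, hAc⟩ := locallyConnectedSpace_iff_subsets_isOpen_isConnected.1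
    ‹LocallyConnectedSpace X› p (N ∩ N' ∩ R.carrier)
    (inter_mem (inter_mem (hNo.mem_nhds hpN) (hN'o.mem_nhds hpN')) (R.isOpen.mem_nhds hp))
  have hAR : A ⊆ R.carrier := fun a ha => (hAN ha).2
  have hARO : ∀ a ∈ A, ∀ b ∈ A, R.br a b ∈ R.carrier ∩ O := fun a ha b hb =>
    hNb (show (a, b) ∈ N ×ˢ N' from ⟨(hAN ha).1.1, (hAN hb).1.2⟩)
  set B := (fun q : X × X => R.br q.1 q.2) '' (A ×ˢ A)
  have hBR : B ⊆ R.carrier ∩ O := by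
    rintro _ ⟨q, hq, rfl⟩
    exact hARO _ hq.1 _ hq.2
  have hBo : IsOpen B := by
    rw [isOpen_iff_mem_nhds]
    rintro _ ⟨⟨a, b⟩, ⟨ha, hb⟩, rfl⟩
    change a ∈ A at ha
    change b ∈ A at hb
    have haR := hAR ha
    have hbR := hAR hb
    have hz := (hARO a ha b hb).1
    -- A point `z` near `[a, b]` is the product of `[z, a]` and `[b, z]`, which lie in `A`.
    have h₁ : ∀ᶠ z in 𝓝 (R.br a b), R.br z a ∈ A := by
      have hc : ContinuousAt (fun z => R.br z a) (R.br a b) :=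
        ContinuousAt.comp (f := fun z => (z, a)) (R.continuousAt_br hz haR)
          (continuousAt_id.prodMk continuousAt_const)
      refine hc (hAo.mem_nhds ?_)
      change R.br (R.br a b) a ∈ A
      rwa [R.br_left a haR b hbR a haR, R.br_self a haR]
    have h₂ : ∀ᶠ z in 𝓝 (R.br a b), R.br b z ∈ A := by
      have hc : ContinuousAt (fun z => R.br b z) (R.br a b) :=
        ContinuousAt.comp (f := fun z => (b, z)) (R.continuousAt_br hbR hz)
          (continuousAt_const.prodMk continuousAt_id)
      refine hc (hAo.mem_nhds ?_)
      change R.br b (R.br a b) ∈ A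
      rwa [R.br_right b hbR a haR b hbR, R.br_self b hbR]
    filter_upwards [h₁, h₂, R.isOpen.mem_nhds hz] with z h₁ h₂ h₃
    refine ⟨(R.br z a, R.br b z), ⟨h₁, h₂⟩, ?_⟩
    change R.br (R.br z a) (R.br b z) = z
    rw [R.br_left z h₃ a haR _ (hAR h₂), R.br_right z h₃ b hbR z h₃, R.br_self z h₃]
  refine ⟨⟨B, hBo, R.br, ?_, ?_, ?_, ?_, ?_⟩, ?_, hBR, rfl, ?_⟩
  · rintro _ ⟨⟨a, b⟩, ⟨ha, hb⟩, rfl⟩ _ ⟨⟨c, d⟩, ⟨hc, hd⟩, rfl⟩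
    refine ⟨(a, d), ⟨ha, hd⟩, ?_⟩
    change R.br a d = R.br (R.br a b) (R.br c d)
    rw [R.br_left a (hAR ha) b (hAR hb) _ (R.br_mem c (hAR hc) d (hAR hd)),
      R.br_right a (hAR ha) c (hAR hc) d (hAR hd)]
  · exact R.continuousOn_br.mono (prod_mono (fun z hz => (hBR hz).1) fun z hz => (hBR hz).1)
  · exact fun x hx => R.br_self x (hBR hx).1
  · exact fun x hx y hy z hz => R.br_left x (hBR hx).1 y (hBR hy).1 z (hBR hz).1
  · exact fun x hx y hy z hz => R.br_right x (hBR hx).1 y (hBR hy).1 z (hBR hz).1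
  · exact ⟨(p, p), ⟨hpA, hpA⟩, R.br_self p hp⟩
  · exact (hAc.isPreconnected.prod hAc.isPreconnected).image _
      (R.continuousOn_br.mono (prod_mono hAR hAR))

/-- The small rectangles over which the arguments take place: they are connected, their product is
the bracket `β`, there are sections of `π` over them through all possible points, and their stable
plaques are uniformly contracted by `f`. -/
structure IsChart (L : LocalProduct X) (f : X ≃ₜ X) (π : M → X) (β : X → X → X)
    (W : OpenRectangle X) : Prop where
  isRectangle : L.IsRectangle W
  isPreconnected : IsPreconnected W.carrier
  br_eq : ∀ x ∈ W.carrier, ∀ y ∈ W.carrier, β x y = W.br x y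
  contracts : ∀ V ∈ 𝓝ˢ (diagonal X), ∀ᶠ n : ℕ in atTop, ∀ x ∈ W.carrier, ∀ y ∈ W.carrier,
    W.br x y = x → (f^[n] x, f^[n] y) ∈ V
  exists_section : ∀ m, π m ∈ W.carrier → ∃ s, IsSectionOn π s W.carrier ∧ s (π m) = m

theorem exists_isChart [LocallyConnectedSpace X] {L : LocalProduct X} {f : X ≃ₜ X}
    (hX : IsSmaleSpace L f) {π : M → X} (hπ : IsCoveringMap π) {β : X → X → X}
    (hβ : L.IsBracket β) (p : X) {O : Set X} (hO : O ∈ 𝓝 p) :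
    ∃ W, IsChart L f π β W ∧ p ∈ W.carrier ∧ W.carrier ⊆ O := by
  obtain ⟨R, hR, hp, hRc⟩ := hX.exists_contracting p
  obtain ⟨U, hU, hUs⟩ := exists_isSectionOn hπ p
  obtain ⟨N, hN, N', hN', hNβ⟩ := mem_nhds_prod_iff.1 (hβ p R hR hp)
  obtain ⟨W, hpW, hWR, hbr, hWc⟩ := R.exists_preconnected_subrectangle hp
    (inter_mem (inter_mem hN hN') (inter_mem hU hO))
  refine ⟨W, ⟨fun S hS x => ?_, hWc, fun x hx y hy => ?_, fun V hV => ?_, ?_⟩, hpW,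
    fun x hx => (hWR hx).2.2.2⟩
  · obtain ⟨U', hU', h⟩ := hR S hS x
    refine ⟨U', hU', fun y hy z hz => ?_⟩
    rw [hbr]
    exact h y ⟨⟨hy.1.1, (hWR hy.1.2).1⟩, hy.2⟩ z ⟨⟨hz.1.1, (hWR hz.1.2).1⟩, hz.2⟩
  · rw [hbr]
    exact hNβ (show (x, y) ∈ N ×ˢ N' from ⟨(hWR hx).2.1.1, (hWR hy).2.1.2⟩)
  · filter_upwards [hRc V hV] with n hn x hx y hy hxy
    exact hn x (hWR hx).1 y (hWR hy).1 (hbr ▸ hxy)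
  · exact hUs W.carrier (fun x hx => (hWR hx).2.2.1) W.isOpen

section Sections

variable {L : LocalProduct X} {D : DirectProduct M} {π : M → X} {W : OpenRectangle X} {s : X → M}

theorem IsSectionOn.eventually_br_eq (hs : IsSectionOn π s W.carrier)
    (hπ : PreservesLocalProduct D.toLocalProduct L π) (hW : L.IsRectangle W) {q : X}
    (hq : q ∈ W.carrier) : ∀ᶠ r in 𝓝 q, W.br q r = q → D.br (s q) (s r) = s q := by
  have hsc : ContinuousAt s q := hs.continuousOn.continuousAt (W.isOpen.mem_nhds hq)
  have h₁ := hπ.eventually_map_br D.toLocalProduct_isRectangle hW (mem_univ (s q))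
    (by rwa [hs.proj q hq])
  have h₂ : ContinuousAt (fun r => D.br (s q) (s r)) q :=
    ContinuousAt.comp (f := fun r => (s q, s r)) D.continuous_br.continuousAt
      (continuousAt_const.prodMk hsc)
  have h₃ : ∀ᶠ r in 𝓝 q, D.br (s q) (s r) ∈ s '' W.carrier := by
    refine h₂ (hs.isOpen_image.mem_nhds ?_)
    change D.br (s q) (s q) ∈ _
    rw [D.br_self]
    exact mem_image_of_mem s hq
  filter_upwards [(continuousAt_const.prodMk hsc : ContinuousAt (fun r => (s q, s r)) q) h₁, h₃,
    W.isOpen.mem_nhds hq] with r h₁ h₃ hr hqr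
  obtain ⟨w, hw, hw'⟩ := h₃
  change π (D.br (s q) (s r)) = W.br (π (s q)) (π (s r)) at h₁
  rw [← hw', hs.proj q hq, hs.proj r hr, hs.proj w hw, hqr] at h₁
  rw [← hw', h₁]

/-- Sections map stable plaques of a connected rectangle into stable plaques of `M`: the point
`[s x, s [y, x]]` is locally constant in `y`. -/
theorem IsSectionOn.br_map_br (hs : IsSectionOn π s W.carrier)
    (hπ : PreservesLocalProduct D.toLocalProduct L π) (hW : L.IsRectangle W)
    (hWc : IsPreconnected W.carrier) {x y : X} (hx : x ∈ W.carrier) (hy : y ∈ W.carrier) :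
    D.br (s x) (s (W.br y x)) = s x := by
  have key : D.br (s x) (s (W.br y x)) = D.br (s x) (s (W.br x x)) := by
    refine hWc.induction₂ (fun u v => D.br (s x) (s (W.br u x)) = D.br (s x) (s (W.br v x)))
      (fun u hu => ?_) (fun _ _ _ _ _ _ h h' => h.trans h') (fun _ _ _ _ h => h.symm) hy hx
    have hux := W.br_mem u hu x hx
    have hc : ContinuousAt (fun v => W.br v x) u :=
      ContinuousAt.comp (f := fun v => (v, x)) (W.continuousAt_br hu hx)
        (continuousAt_id.prodMk continuousAt_const)
    filter_upwards [mem_nhdsWithin_of_mem_nhds (hc (hs.eventually_br_eq hπ hW hux)),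
      self_mem_nhdsWithin] with v hv hvW
    have hvx := W.br_mem v hvW x hx
    have h : D.br (s (W.br u x)) (s (W.br v x)) = s (W.br u x) :=
      hv (by rw [W.br_left u hu x hx _ hvx, W.br_right u hu v hvW x hx])
    rw [← h, D.br_right]
  rw [key, W.br_self x hx, D.br_self]

theorem IsSectionOn.op (hs : IsSectionOn π s W.carrier) : IsSectionOn π s W.op.carrier := hs

/-- Sections over connected rectangles are homomorphisms. -/
theorem IsSectionOn.map_br (hs : IsSectionOn π s W.carrier)
    (hπ : PreservesLocalProduct D.toLocalProduct L π)
    (hπ' : PreservesLocalProduct D.op.toLocalProduct L.op π) (hW : L.IsRectangle W)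
    (hWc : IsPreconnected W.carrier) {x y : X} (hx : x ∈ W.carrier) (hy : y ∈ W.carrier) :
    s (W.br x y) = D.br (s x) (s y) := by
  have h₁ : D.br (s y) (s (W.br x y)) = s y := hs.br_map_br hπ hW hWc hy hx
  have h₂ : D.br (s (W.br x y)) (s x) = s x := hs.op.br_map_br hπ' hW.op hWc hx hy
  calc s (W.br x y) = D.br (s x) (s (W.br x y)) := (D.br_eq_right_iff.2 h₂).symm
    _ = D.br (s x) (D.br (s y) (s (W.br x y))) := (D.br_right _ _ _).symm
    _ = D.br (s x) (s y) := by rw [h₁]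

end Sections

/-! ### Stable plaques of a splitting -/

/-- A Smale space together with a splitting of it and a lift of its homeomorphism. -/
structure IsLiftedSplitting (L : LocalProduct X) (f : X ≃ₜ X) (D : DirectProduct M) (π : M → X)
    (F : M ≃ₜ M) : Prop where
  smale : IsSmaleSpace L f
  splitting : IsSplitting L f D π
  lift : IsLift f D π F

namespace IsLiftedSplitting

variable {L : LocalProduct X} {f : X ≃ₜ X} {D : DirectProduct M} {π : M → X} {F : M ≃ₜ M}

theorem op (S : IsLiftedSplitting L f D π F) : IsLiftedSplitting L.op f.symm D.op π F.symm :=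
  ⟨S.smale.op, S.splitting.op, S.lift.op⟩

theorem continuous (S : IsLiftedSplitting L f D π F) : Continuous π := S.splitting.preserves.1

theorem t2Space (S : IsLiftedSplitting L f D π F) : T2Space M := by
  have := S.smale.t2Space
  refine ⟨fun a b hab => ?_⟩
  by_cases h : π a = π b
  · exact S.splitting.isCoveringMap.isSeparatedMap a b h hab
  · obtain ⟨U, V, hU, hV, haU, hbV, hUV⟩ := t2_separation h
    exact ⟨π ⁻¹' U, π ⁻¹' V, hU.preimage S.continuous, hV.preimage S.continuous, haU, hbV,
      hUV.preimage π⟩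

theorem proj_iterate (S : IsLiftedSplitting L f D π F) (n : ℕ) (a : M) :
    π (F^[n] a) = f^[n] (π a) := by
  induction n with
  | zero => rfl
  | succ n ih => rw [Function.iterate_succ_apply', Function.iterate_succ_apply', S.lift.comm, ih]

theorem iterate_br (S : IsLiftedSplitting L f D π F) (n : ℕ) (a b : M) :
    F^[n] (D.br a b) = D.br (F^[n] a) (F^[n] b) := by
  induction n with
  | zero => rfl
  | succ n ih => simp only [Function.iterate_succ_apply', ih, S.lift.map_br]

theorem iterate_br_eq (S : IsLiftedSplitting L f D π F) (n : ℕ) {a b : M} (h : D.br a b = a) :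
    D.br (F^[n] a) (F^[n] b) = F^[n] a := by rw [← S.iterate_br, h]

theorem eq_of_proj_eq (S : IsLiftedSplitting L f D π F) {m a b : M} (ha : D.br m a = m)
    (hb : D.br m b = m) (h : π a = π b) : a = b := by
  obtain ⟨U, hU⟩ := S.smale.exists_isExpansiveNhd
  obtain ⟨hm, hh⟩ := S.splitting.stable m
  have hinj := (@IsHomeomorph.bijective _ _ _ (leafTopology f U (π m)) _ (hh U hU)).1
  exact congrArg Subtype.val (hinj (a₁ := ⟨a, ha⟩) (a₂ := ⟨b, hb⟩) (Subtype.ext h))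

theorem proj_mem_leaf (S : IsLiftedSplitting L f D π F) {a b : M} (h : D.br a b = a) :
    π b ∈ leaf f (π a) :=
  (S.splitting.stable a).1 h

theorem map_br_section (S : IsLiftedSplitting L f D π F) {W : OpenRectangle X}
    (hW : L.IsRectangle W) (hWc : IsPreconnected W.carrier) {s : X → M}
    (hs : IsSectionOn π s W.carrier) {x y : X} (hx : x ∈ W.carrier) (hy : y ∈ W.carrier) :
    s (W.br x y) = D.br (s x) (s y) :=
  hs.map_br S.splitting.preserves S.op.splitting.preserves hW hWc hx hy

/-- Two points of a stable plaque of `M` are moved by high powers of `F` into one sheet of the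
splitting over an arbitrarily small chart. -/
theorem eventually_exists_section [LocallyConnectedSpace X] (S : IsLiftedSplitting L f D π F)
    {β : X → X → X} (hβ : L.IsBracket β) {a b : M} (hab : D.br a b = a) {O : X → Set X}
    (hO : ∀ p, O p ∈ 𝓝 p) :
    ∀ᶠ n : ℕ in atTop, ∃ p W s, IsChart L f π β W ∧ W.carrier ⊆ O p ∧ IsSectionOn π s W.carrier ∧
      π (F^[n] a) ∈ W.carrier ∧ π (F^[n] b) ∈ W.carrier ∧ s (π (F^[n] a)) = F^[n] a ∧
      s (π (F^[n] b)) = F^[n] b := by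
  choose W hW hpW hWO using fun p => exists_isChart S.smale S.splitting.isCoveringMap hβ p (hO p)
  have hV : (⋃ p, (W p).carrier ×ˢ (W p).carrier) ∈ 𝓝ˢ (diagonal X) := by
    rw [mem_nhdsSet_iff_forall]
    rintro ⟨p, q⟩ hpq
    obtain rfl : p = q := hpq
    exact mem_of_superset (prod_mem_nhds ((W p).isOpen.mem_nhds (hpW p))
      ((W p).isOpen.mem_nhds (hpW p))) (subset_iUnion_of_subset p Subset.rfl)
  have hleaf := S.proj_mem_leaf hab
  filter_upwards [hleaf.eventually hV, S.smale.eventually_bracket_eq hβ hleaf] with n hn hn'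
  rw [← S.proj_iterate, ← S.proj_iterate] at hn hn'
  obtain ⟨p, hpa, hpb⟩ := mem_iUnion.1 hn
  obtain ⟨s, hs, hsa⟩ := (hW p).exists_section (F^[n] a) hpa
  refine ⟨p, W p, s, hW p, hWO p, hs, hpa, hpb, hsa, ?_⟩
  refine S.eq_of_proj_eq (m := F^[n] a) ?_ (S.iterate_br_eq n hab) (hs.proj _ hpb)
  have h := S.map_br_section (hW p).isRectangle (hW p).isPreconnected hs hpa hpb
  rw [← (hW p).br_eq _ hpa _ hpb, hn', hsa] at h
  exact h.symm

theorem mem_connectedComponent [LocallyConnectedSpace X] (S : IsLiftedSplitting L f D π F)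
    {a b : M} (hab : D.br a b = a) : b ∈ connectedComponent a := by
  obtain ⟨β, hβ⟩ := S.smale.exists_isBracket
  obtain ⟨n, -, W, s, hW, -, hs, ha, hb, hsa, hsb⟩ :=
    (S.eventually_exists_section hβ hab (O := fun _ => univ) fun _ => univ_mem).exists
  have hl : Function.LeftInverse F.symm^[n] F^[n] :=
    Function.LeftInverse.iterate F.symm_apply_apply n
  have hc : Continuous F.symm^[n] := F.symm.continuous.iterate n
  have hcon := (hW.isPreconnected.image s hs.continuousOn).image _ hc.continuousOn
  refine hcon.subset_connectedComponent ⟨_, mem_image_of_mem s ha, ?_⟩ ⟨_, mem_image_of_mem s hb, ?_⟩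
  · rw [hsa, hl]
  · rw [hsb, hl]

theorem connectedSpace [LocallyConnectedSpace X] [Nonempty X]
    (S : IsLiftedSplitting L f D π F) : ConnectedSpace M := by
  have : Nonempty M := S.splitting.surjective.nonempty
  have : PreconnectedSpace M := by
    refine preconnectedSpace_iff_connectedComponent.2 fun x => eq_univ_of_forall fun y => ?_
    -- `[x, y]` lies in the unstable plaque of `x` and in the stable plaque of `y`.
    have h₁ : D.br x y ∈ connectedComponent x := by
      refine mem_connectedComponent (X := X) S.op ?_
      change D.br (D.br x y) x = x
      rw [D.br_left, D.br_self]
    have h₂ : D.br x y ∈ connectedComponent y := by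
      refine S.mem_connectedComponent ?_
      rw [D.br_right, D.br_self]
    rw [connectedComponent_eq h₁, ← connectedComponent_eq h₂]
    exact _root_.mem_connectedComponent
  exact ⟨‹_›⟩

/-- High powers of `f` bring the projections of two points of a common stable plaque close
together, uniformly for all pairs from a compact set and their translates by deck
transformations. -/
theorem eventually_close [LocallyConnectedSpace X] (S : IsLiftedSplitting L f D π F)
    {K : Set (M × M)} (hK : IsCompact K) {V : Set (X × X)} (hV : V ∈ 𝓝ˢ (diagonal X)) :
    ∀ᶠ n : ℕ in atTop, ∀ a b, (∃ g ∈ deckGroup D π, (g a, g b) ∈ K) → D.br a b = a →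
      (f^[n] (π a), f^[n] (π b)) ∈ V := by
  have := S.t2Space
  obtain ⟨β, hβ⟩ := S.smale.exists_isBracket
  have key : ∀ᶠ n : ℕ in atTop, ∀ q ∈ K, D.br q.1 q.2 = q.1 →
      (f^[n] (π q.1), f^[n] (π q.2)) ∈ V := by
    refine hK.induction_on (p := fun K => ∀ᶠ n : ℕ in atTop, ∀ q ∈ K, D.br q.1 q.2 = q.1 →
      (f^[n] (π q.1), f^[n] (π q.2)) ∈ V) (by simp) (fun s t hst h => ?_) (fun s t hs ht => ?_)
      fun q _ => ?_
    · filter_upwards [h] with n hn q hq using hn q (hst hq)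
    · filter_upwards [hs, ht] with n hs ht q hq
      exact hq.elim (hs q) (ht q)
    · obtain ⟨a, b⟩ := q
      by_cases hab : D.br a b = a
      · obtain ⟨N, -, W, s, hW, -, hs, ha, hb, hsa, hsb⟩ :=
          (S.eventually_exists_section hβ hab (O := fun _ => univ) fun _ => univ_mem).exists
        have hN : Continuous F^[N] := F.continuous.iterate N
        have hna : F^[N] ⁻¹' (s '' W.carrier) ∈ 𝓝 a :=
          (hs.isOpen_image.preimage hN).mem_nhds ⟨_, ha, hsa⟩
        have hnb : F^[N] ⁻¹' (s '' W.carrier) ∈ 𝓝 b :=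
          (hs.isOpen_image.preimage hN).mem_nhds ⟨_, hb, hsb⟩
        refine ⟨_, mem_nhdsWithin_of_mem_nhds (prod_mem_nhds hna hnb), ?_⟩
        obtain ⟨n₀, hn₀⟩ := eventually_atTop.1 (hW.contracts V hV)
        filter_upwards [eventually_ge_atTop (n₀ + N)] with n hn
        rintro ⟨c, d⟩ ⟨⟨x, hx, hxc⟩, ⟨y, hy, hyd⟩⟩ hcd
        change D.br c d = c at hcd
        have h₁ : W.br x y = x := by
          rw [← hs.proj _ (W.br_mem x hx y hy),
            S.map_br_section hW.isRectangle hW.isPreconnected hs hx hy, hxc, hyd,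
            S.iterate_br_eq N hcd, ← hxc, hs.proj x hx]
        have h₂ := hn₀ (n - N) (by omega) x hx y hy h₁
        rw [← hs.proj x hx, ← hs.proj y hy, hxc, hyd, S.proj_iterate, S.proj_iterate,
          ← Function.iterate_add_apply, ← Function.iterate_add_apply,
          Nat.sub_add_cancel (by omega)] at h₂
        exact h₂
      · refine ⟨{q | D.br q.1 q.2 ≠ q.1}, mem_nhdsWithin_of_mem_nhds ?_, ?_⟩
        · exact (isOpen_ne_fun D.continuous_br continuous_fst).mem_nhds hab
        · exact Eventually.of_forall fun n q hq h => (hq h).elim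
  filter_upwards [key] with n hn a b hg hab
  obtain ⟨g, hg, hgK⟩ := hg
  have := hn _ hgK (by rw [← hg.1, hab])
  rwa [hg.2, hg.2] at this

end IsLiftedSplitting

/-! ### Deck transformations -/

theorem _root_.IsHomeomorph.exists_homeomorph_comp_eq {A B C : Type*} [TopologicalSpace A]
    [TopologicalSpace B] [TopologicalSpace C] {u : A → C} {v : B → C} (hu : IsHomeomorph u)
    (hv : IsHomeomorph v) : ∃ e : A ≃ₜ B, ∀ a, v (e a) = u a :=
  ⟨hu.homeomorph.trans hv.homeomorph.symm, fun a => hv.homeomorph.apply_symm_apply (u a)⟩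

/-- The coordinates of the direct product `M` given by the two plaques of a point. The
second plaque is written as a first plaque of the opposite structure, to which the statements on
stable plaques apply. -/
def DirectProduct.coord (D : DirectProduct M) (m : M) : M ≃ₜ D.plaque₁ m × D.op.plaque₁ m where
  toFun y := (⟨D.br y m, (D.br_right m y m).trans (D.br_self m)⟩,
    ⟨D.br m y, (D.br_left m y m).trans (D.br_self m)⟩)
  invFun p := D.br p.1 p.2
  left_inv y := by
    change D.br (D.br y m) (D.br m y) = y
    rw [D.br_left, D.br_right, D.br_self]
  right_inv := by
    rintro ⟨⟨p, hp⟩, ⟨q, hq⟩⟩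
    refine Prod.ext (Subtype.ext ?_) (Subtype.ext ?_)
    · exact (D.br_left p q m).trans (D.br_eq_left_iff.1 hp)
    · exact (D.br_right m p q).trans (D.br_eq_right_iff.2 hq)
  continuous_toFun := ((D.continuous_br' continuous_id continuous_const).subtype_mk _).prodMk
    ((D.continuous_br' continuous_const continuous_id).subtype_mk _)
  continuous_invFun := D.continuous_br' (continuous_subtype_val.comp continuous_fst)
    (continuous_subtype_val.comp continuous_snd)

namespace IsLiftedSplitting

variable {L : LocalProduct X} {f : X ≃ₜ X} {D : DirectProduct M} {π : M → X} {F : M ≃ₜ M}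

theorem exists_plaque_homeomorph (S : IsLiftedSplitting L f D π F) {m m' : M} (h : π m = π m') :
    ∃ e : D.plaque₁ m ≃ₜ D.plaque₁ m', ∀ a, π (e a) = π a := by
  obtain ⟨U, hU⟩ := S.smale.exists_isExpansiveNhd
  obtain ⟨hm, hh⟩ := S.splitting.stable m
  obtain ⟨hm', hh'⟩ := h ▸ S.splitting.stable m'
  obtain ⟨e, he⟩ := @IsHomeomorph.exists_homeomorph_comp_eq _ _ _ _ _ (leafTopology f U (π m)) _ _
    (hh U hU) (hh' U hU)
  exact ⟨e, fun a => congrArg Subtype.val (he a)⟩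

/-- Identifications of the stable and of the unstable plaques of two points of a fibre, which
commute with `π`, are the factors of a map that commutes with `π`. For a fixed point `α` of the
stable plaque, the set of `β` in the unstable plaque with `π [α, β] = π [e₁ α, e₂ β]` is open:
after applying a high power of `F`, the thin strip between `β` and `[α, β]` lies in one sheet of the
splitting, and its counterpart between `e₂ β` and `[e₁ α, e₂ β]` in a sheet over the same chart. -/
theorem proj_br_eq [LocallyConnectedSpace X] [Nonempty X] (S : IsLiftedSplitting L f D π F)
    {m m' : M} (h : π m = π m') (e₁ : D.plaque₁ m ≃ₜ D.plaque₁ m') (he₁ : ∀ a, π (e₁ a) = π a)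
    (e₂ : D.op.plaque₁ m ≃ₜ D.op.plaque₁ m') (he₂ : ∀ a, π (e₂ a) = π a)
    (α : D.plaque₁ m) (y : M) :
    π (D.br α (D.coord m y).2) = π (D.br (e₁ α) (e₂ (D.coord m y).2)) := by
  have := S.connectedSpace
  have := S.t2Space
  have := S.smale.t2Space
  obtain ⟨β, hβ⟩ := S.smale.exists_isBracket
  set u : M → M := fun y => (D.coord m y).2
  set v : M → M := fun y => e₂ (D.coord m y).2
  have hπv : ∀ y, π (v y) = π (u y) := fun y => he₂ _
  have huc : Continuous u :=
    continuous_subtype_val.comp (continuous_snd.comp (D.coord m).continuous)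
  have hvc : Continuous v := continuous_subtype_val.comp
    (e₂.continuous.comp (continuous_snd.comp (D.coord m).continuous))
  change π (D.br α (u y)) = π (D.br (e₁ α) (v y))
  suffices h : {y | π (D.br α (u y)) = π (D.br (e₁ α) (v y))} = univ from
    eq_univ_iff_forall.1 h y
  refine IsClopen.eq_univ ⟨?_, ?_⟩ ⟨m, ?_⟩
  · exact isClosed_eq (S.continuous.comp (D.continuous_br' continuous_const huc))
      (S.continuous.comp (D.continuous_br' continuous_const hvc))
  · rw [isOpen_iff_mem_nhds]
    intro y₀ hy₀
    change π (D.br α (u y₀)) = π (D.br (e₁ α) (v y₀)) at hy₀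
    obtain ⟨n, -, W, s, hW, -, hs, hx, hy, hsx, hsy⟩ :=
      (S.eventually_exists_section hβ (a := u y₀) (b := D.br α (u y₀))
        (by rw [D.br_right, D.br_self]) (O := fun _ => univ) fun _ => univ_mem).exists
    set x₁ := π (F^[n] (u y₀)) with hx₁
    set x₂ := π (F^[n] (D.br α (u y₀))) with hx₂
    have hvx : π (F^[n] (v y₀)) = x₁ := by rw [S.proj_iterate, hπv, ← S.proj_iterate]
    obtain ⟨s', hs', hsv⟩ := hW.exists_section (F^[n] (v y₀)) (hvx ▸ hx)
    rw [hvx] at hsv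
    have hbr : W.br x₁ x₂ = x₁ := by
      rw [← hs.proj _ (W.br_mem _ hx _ hy),
        S.map_br_section hW.isRectangle hW.isPreconnected hs hx hy, hsx, hsy, ← S.iterate_br,
        D.br_right, D.br_self]
    -- The section `s'` through `v y₀` also passes through `[e₁ α, v y₀]`.
    have hsv' : s' x₂ = F^[n] (D.br (e₁ α) (v y₀)) := by
      refine S.eq_of_proj_eq (m := F^[n] (v y₀)) ?_ ?_ ?_
      · rw [← hsv, ← S.map_br_section hW.isRectangle hW.isPreconnected hs' hx hy, hbr]
      · rw [← S.iterate_br, D.br_right, D.br_self]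
      · rw [hs'.proj _ hy, hx₂, S.proj_iterate, S.proj_iterate, hy₀]
    have hn : Continuous F^[n] := F.continuous.iterate n
    have h₁ : ∀ᶠ y in 𝓝 y₀, F^[n] (u y) ∈ s '' W.carrier :=
      (hs.isOpen_image.preimage (hn.comp huc)).mem_nhds ⟨x₁, hx, hsx⟩
    have h₂ : ∀ᶠ y in 𝓝 y₀, F^[n] (v y) ∈ s' '' W.carrier :=
      (hs'.isOpen_image.preimage (hn.comp hvc)).mem_nhds ⟨x₁, hx, hsv⟩
    filter_upwards [h₁, h₂] with y h₁ h₂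
    obtain ⟨z, hz, hzu⟩ := h₁
    obtain ⟨z', hz', hzv⟩ := h₂
    obtain rfl : z' = z := by
      rw [← hs'.proj z' hz', ← hs.proj z hz, hzu, hzv, S.proj_iterate, S.proj_iterate, hπv]
    have h₃ : F^[n] (D.br α (u y)) = s (W.br x₂ z') := by
      rw [S.map_br_section hW.isRectangle hW.isPreconnected hs hy hz, hsy, hzu, ← S.iterate_br,
        D.br_left]
    have h₄ : F^[n] (D.br (e₁ α) (v y)) = s' (W.br x₂ z') := by
      rw [S.map_br_section hW.isRectangle hW.isPreconnected hs' hy hz, hsv', hzv, ← S.iterate_br,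
        D.br_left]
    change π (D.br α (u y)) = π (D.br (e₁ α) (v y))
    apply f.injective.iterate n
    rw [← S.proj_iterate, ← S.proj_iterate, h₃, h₄, hs.proj _ (W.br_mem _ hy _ hz),
      hs'.proj _ (W.br_mem _ hy _ hz)]
  · have h₁ : D.br α (u m) = α := by
      change D.br α (D.br m m) = α
      rw [D.br_self]
      exact D.br_eq_left_iff.1 α.2
    have h₂ : v m = m' := by
      refine S.op.eq_of_proj_eq (m := m') (e₂ (D.coord m m).2).2 (D.br_self m') ?_
      rw [he₂, ← h]
      exact congrArg π (D.br_self m)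
    change π (D.br α (u m)) = π (D.br (e₁ α) (v m))
    rw [h₁, h₂, D.br_eq_left_iff.1 (e₁ α).2, he₁]

/-- The group of deck transformations is transitive on the fibres. -/
theorem exists_deck [LocallyConnectedSpace X] [Nonempty X] (S : IsLiftedSplitting L f D π F)
    {m m' : M} (h : π m = π m') : ∃ g ∈ deckGroup D π, g m = m' := by
  obtain ⟨e₁, he₁⟩ := S.exists_plaque_homeomorph h
  obtain ⟨e₂, he₂⟩ := S.op.exists_plaque_homeomorph h
  refine ⟨(D.coord m).trans ((e₁.prodCongr e₂).trans (D.coord m').symm),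
    ⟨fun x y => ?_, fun y => ?_⟩, ?_⟩
  · have h₁ : (D.coord m (D.br x y)).1 = (D.coord m x).1 := Subtype.ext (D.br_left x y m)
    have h₂ : (D.coord m (D.br x y)).2 = (D.coord m y).2 := Subtype.ext (D.br_right m x y)
    change D.br (e₁ (D.coord m (D.br x y)).1) (e₂ (D.coord m (D.br x y)).2) =
      D.br (D.br (e₁ (D.coord m x).1) (e₂ (D.coord m x).2))
        (D.br (e₁ (D.coord m y).1) (e₂ (D.coord m y).2))
    rw [h₁, h₂, D.br_left, D.br_right]
  · refine (S.proj_br_eq h e₁ he₁ e₂ he₂ (D.coord m y).1 y).symm.trans ?_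
    exact congrArg π ((D.coord m).left_inv y)
  · change D.br (e₁ (D.coord m m).1) (e₂ (D.coord m m).2) = m'
    have h₁ : (e₁ (D.coord m m).1 : M) = m' := by
      refine S.eq_of_proj_eq (m := m') (e₁ (D.coord m m).1).2 (D.br_self m') ?_
      rw [he₁, ← h]
      exact congrArg π (D.br_self m)
    have h₂ : (e₂ (D.coord m m).2 : M) = m' := by
      refine S.op.eq_of_proj_eq (m := m') (e₂ (D.coord m m).2).2 (D.br_self m') ?_
      rw [he₂, ← h]
      exact congrArg π (D.br_self m)
    rw [h₁, h₂, D.br_self]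

theorem exists_isCompact_image_eq_univ [LocallyConnectedSpace X]
    (S : IsLiftedSplitting L f D π F) : ∃ K : Set M, IsCompact K ∧ π '' K = univ := by
  have := S.smale.compact
  have := S.smale.t2Space
  obtain ⟨β, hβ⟩ := S.smale.exists_isBracket
  have key : ∃ K : Set M, IsCompact K ∧ univ ⊆ π '' K := by
    refine isCompact_univ.induction_on (p := fun A : Set X => ∃ K : Set M, IsCompact K ∧ A ⊆ π '' K)
      ⟨∅, isCompact_empty, empty_subset _⟩ (fun A B hAB ⟨K, hK, hB⟩ => ⟨K, hK, hAB.trans hB⟩)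
      (fun A B ⟨K, hK, hA⟩ ⟨K', hK', hB⟩ => ⟨K ∪ K', hK.union hK', ?_⟩) fun p _ => ?_
    · rw [image_union]
      exact union_subset_union hA hB
    · obtain ⟨W, hW, hpW, -⟩ :=
        exists_isChart S.smale S.splitting.isCoveringMap hβ p (univ_mem (f := 𝓝 p))
      obtain ⟨m, rfl⟩ := S.splitting.surjective p
      obtain ⟨s, hs, -⟩ := hW.exists_section m hpW
      obtain ⟨C, hC, hCW, hCc⟩ := local_compact_nhds (W.isOpen.mem_nhds hpW)
      exact ⟨C, mem_nhdsWithin_of_mem_nhds hC, s '' C, hCc.image_of_continuousOn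
        (hs.continuousOn.mono hCW), fun x hx => ⟨s x, mem_image_of_mem s hx, hs.proj x (hCW hx)⟩⟩
  obtain ⟨K, hK, hKu⟩ := key
  exact ⟨K, hK, univ_subset_iff.1 hKu⟩

theorem exists_isCompact_forall_exists_deck [LocallyConnectedSpace X] [Nonempty X]
    (S : IsLiftedSplitting L f D π F) :
    ∃ K : Set M, IsCompact K ∧ ∀ y, ∃ g ∈ deckGroup D π, g y ∈ K := by
  obtain ⟨K, hK, hKu⟩ := S.exists_isCompact_image_eq_univ
  refine ⟨K, hK, fun y => ?_⟩
  obtain ⟨k, hk, hky⟩ := hKu.symm ▸ mem_univ (π y)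
  obtain ⟨g, hg, hgk⟩ := S.exists_deck hky.symm
  exact ⟨g, hg, hgk ▸ hk⟩

theorem deck_eq_of_apply_eq [LocallyConnectedSpace X] [Nonempty X]
    (S : IsLiftedSplitting L f D π F) {g g' : M ≃ₜ M} (hg : g ∈ deckGroup D π)
    (hg' : g' ∈ deckGroup D π) {m : M} (h : g m = g' m) : g = g' := by
  have := S.connectedSpace
  refine Homeomorph.ext fun x => congrFun (S.splitting.isCoveringMap.eq_of_comp_eq g.continuous
    g'.continuous (funext fun x => ?_) m h) x
  exact (hg.2 x).trans (hg'.2 x).symm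

/-- The deck transformations act properly discontinuously. -/
theorem finite_deck [LocallyConnectedSpace X] [Nonempty X] (S : IsLiftedSplitting L f D π F)
    {C : Set M} (hC : IsCompact C) : {g ∈ deckGroup D π | ∃ a ∈ C, g a ∈ C}.Finite := by
  have := S.smale.t2Space
  obtain ⟨β, hβ⟩ := S.smale.exists_isBracket
  have key : {g | g ∈ deckGroup D π ∧ ∃ q ∈ C ×ˢ C, g q.1 = q.2}.Finite := by
    refine (hC.prod hC).induction_on
      (p := fun A : Set (M × M) => {g | g ∈ deckGroup D π ∧ ∃ q ∈ A, g q.1 = q.2}.Finite) (by simp)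
      (fun A B hAB h => h.subset ?_) (fun A B hA hB => (hA.union hB).subset ?_) fun q _ => ?_
    · rintro g ⟨hg, q, hq, h⟩
      exact ⟨hg, q, hAB hq, h⟩
    · rintro g ⟨hg, q, hq | hq, h⟩
      · exact Or.inl ⟨hg, q, hq, h⟩
      · exact Or.inr ⟨hg, q, hq, h⟩
    · obtain ⟨a, b⟩ := q
      by_cases hab : π a = π b
      · obtain ⟨W, hW, haW, -⟩ :=
          exists_isChart S.smale S.splitting.isCoveringMap hβ (π a) univ_mem
        obtain ⟨s, hs, hsa⟩ := hW.exists_section a haW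
        obtain ⟨s', hs', hsb⟩ := hW.exists_section b (hab ▸ haW)
        refine ⟨(s '' W.carrier) ×ˢ (s' '' W.carrier), mem_nhdsWithin_of_mem_nhds
          (prod_mem_nhds (hs.isOpen_image.mem_nhds ⟨_, haW, hsa⟩)
            (hs'.isOpen_image.mem_nhds ⟨_, hab ▸ haW, hsb⟩)), ?_⟩
        -- Such a deck transformation maps the sheet of `a` to the sheet of `b`, hence `a` to `b`.
        have hgab : ∀ g ∈ {g | g ∈ deckGroup D π ∧
            ∃ q ∈ (s '' W.carrier) ×ˢ (s' '' W.carrier), g q.1 = q.2}, g a = b := by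
          rintro g ⟨hg, ⟨_, _⟩, ⟨⟨x, hx, rfl⟩, ⟨x', hx', rfl⟩⟩, h⟩
          change g (s x) = s' x' at h
          obtain rfl : x = x' := by rw [← hs.proj x hx, ← hs'.proj x' hx', ← h, hg.2]
          have h₁ := S.splitting.isCoveringMap.eqOn_of_comp_eqOn hW.isPreconnected
            (g.continuous.comp_continuousOn hs.continuousOn) hs'.continuousOn
            (fun z hz => (hg.2 (s z)).trans ((hs.proj z hz).trans (hs'.proj z hz).symm)) hx h haW
          rw [← hsb, ← hab, ← h₁, Function.comp_apply, hsa]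
        refine Set.Subsingleton.finite fun g hg g' hg' => ?_
        exact S.deck_eq_of_apply_eq hg.1 hg'.1 ((hgab g hg).trans (hgab g' hg').symm)
      · obtain ⟨N, N', hN, hN', haN, hbN', hd⟩ := t2_separation hab
        refine ⟨(π ⁻¹' N) ×ˢ (π ⁻¹' N'), mem_nhdsWithin_of_mem_nhds (prod_mem_nhds
          ((hN.preimage S.continuous).mem_nhds haN) ((hN'.preimage S.continuous).mem_nhds hbN')),
          ?_⟩
        convert Set.finite_empty
        refine eq_empty_of_forall_notMem ?_
        rintro g ⟨hg, ⟨c, d⟩, ⟨hc, hd'⟩, h⟩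
        refine hd.ne_of_mem hc hd' ?_
        rw [← hg.2 c]
        exact congrArg π h
  refine key.subset ?_
  rintro g ⟨hg, a, ha, hga⟩
  exact ⟨hg, (a, g a), ⟨ha, hga⟩, rfl⟩

end IsLiftedSplitting

/-! ### Semiconjugacies between lifts -/

theorem semiconj_zpow {Z Z' : Type*} [TopologicalSpace Z] [TopologicalSpace Z'] {F : Z ≃ₜ Z}
    {f : Z' ≃ₜ Z'} {u : Z → Z'} (h : ∀ x, u (F x) = f (u x)) (k : ℤ) (x : Z) :
    u ((F ^ k) x) = (f ^ k) (u x) := by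
  have h' : ∀ x, u (F.symm x) = f.symm (u x) := fun x => by
    apply f.injective
    rw [← h, F.apply_symm_apply, f.apply_symm_apply]
  rcases k.eq_nat_or_neg with ⟨n, rfl | rfl⟩
  · rw [zpow_natCast_apply, zpow_natCast_apply]
    exact Function.Semiconj.iterate_right (f := u) h n x
  · rw [zpow_neg_natCast_apply, zpow_neg_natCast_apply]
    exact Function.Semiconj.iterate_right (f := u) h' n x

variable {X' M' : Type*} [TopologicalSpace X'] [TopologicalSpace M']

namespace IsLiftedSplitting

variable {L : LocalProduct X} {f : X ≃ₜ X} {D : DirectProduct M} {π : M → X} {F : M ≃ₜ M}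
  {L' : LocalProduct X'} {f' : X' ≃ₜ X'} {D' : DirectProduct M'} {π' : M' → X'} {F' : M' ≃ₜ M'}

theorem proj_zpow (S : IsLiftedSplitting L f D π F) (k : ℤ) (a : M) :
    π ((F ^ k) a) = (f ^ k) (π a) := semiconj_zpow S.lift.comm k a

theorem zpow_br (S : IsLiftedSplitting L f D π F) (k : ℤ) (a b : M) :
    (F ^ k) (D.br a b) = D.br ((F ^ k) a) ((F ^ k) b) := by
  rcases k.eq_nat_or_neg with ⟨n, rfl | rfl⟩
  · simp only [zpow_natCast_apply]
    exact S.iterate_br n a b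
  · simp only [zpow_neg_natCast_apply]
    exact S.op.iterate_br n b a

/-- A semiconjugacy `Φ` of the lifts that covers a continuous map `h` maps stable plaques into
stable plaques: if `a` and `b` lie in a stable plaque, then for large `n` the points `Fⁿ a` and
`Fⁿ b` lie in one sheet over a chart so small that `h` maps it into a chart, hence their images
under `Φ` lie in one sheet. -/
theorem map_stable_plaque [LocallyConnectedSpace X] [LocallyConnectedSpace X']
    (S : IsLiftedSplitting L f D π F) (S' : IsLiftedSplitting L' f' D' π' F') {Φ : M → M'}
    (hΦ : Continuous Φ) (hΦF : ∀ x, Φ (F x) = F' (Φ x)) {h : X → X'} (hh : Continuous h)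
    (hπ : ∀ x, h (π x) = π' (Φ x)) {a b : M} (hab : D.br a b = a) :
    D'.br (Φ a) (Φ b) = Φ a := by
  obtain ⟨β, hβ⟩ := S.smale.exists_isBracket
  obtain ⟨β', hβ'⟩ := S'.smale.exists_isBracket
  have hΦn : ∀ (n : ℕ) x, Φ (F^[n] x) = F'^[n] (Φ x) := fun n x =>
    Function.Semiconj.iterate_right (f := Φ) hΦF n x
  have hhn : ∀ (n : ℕ) x, h (f^[n] (π x)) = f'^[n] (π' (Φ x)) := fun n x => by
    rw [← S.proj_iterate, hπ, hΦn, S'.proj_iterate]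
  choose W' hW' hpW' _ using fun p : X =>
    exists_isChart S'.smale S'.splitting.isCoveringMap hβ' (h p) univ_mem
  have hleaf : π' (Φ b) ∈ leaf f' (π' (Φ a)) := by
    have ht : Tendsto (Prod.map h h) (𝓝ˢ (diagonal X)) (𝓝ˢ (diagonal X')) :=
      (hh.prodMap hh).tendsto_nhdsSet fun q hq => congrArg h hq
    refine (ht.comp (S.proj_mem_leaf hab)).congr fun n => ?_
    exact Prod.ext (hhn n a) (hhn n b)
  obtain ⟨n, ⟨p, W, s, hW, hWO, hs, hx, hy, hsx, hsy⟩, hn⟩ :=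
    ((S.eventually_exists_section hβ hab (O := fun p => h ⁻¹' (W' p).carrier) fun p =>
      hh.continuousAt ((W' p).isOpen.mem_nhds (hpW' p))).and
      (S'.smale.eventually_bracket_eq hβ' hleaf)).exists
  set x := π (F^[n] a)
  set y := π (F^[n] b)
  rw [← hhn, ← hhn, ← S.proj_iterate, ← S.proj_iterate] at hn
  obtain ⟨s', hs', hsx'⟩ := (hW' p).exists_section (Φ (F^[n] a)) (by rw [← hπ]; exact hWO hx)
  rw [← hπ] at hsx'
  have hlift := S'.splitting.isCoveringMap.eqOn_of_comp_eqOn (g₁ := Φ ∘ s) (g₂ := s' ∘ h)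
    hW.isPreconnected (hΦ.comp_continuousOn hs.continuousOn)
    (hs'.continuousOn.comp hh.continuousOn fun z hz => hWO hz)
    (fun z hz => by
      change π' (Φ (s z)) = π' (s' (h z))
      rw [← hπ, hs.proj z hz, hs'.proj _ (hWO hz)]) hx
    (by rw [Function.comp_apply, Function.comp_apply, hsx, hsx']) hy
  have hΦb : Φ (F^[n] b) = s' (h y) := by rw [← hsy]; exact hlift
  apply F'.injective.iterate n
  rw [S'.iterate_br, ← hΦn, ← hΦn, hΦb, ← hsx',
    ← S'.map_br_section (hW' p).isRectangle (hW' p).isPreconnected hs' (hWO hx) (hWO hy),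
    ← (hW' p).br_eq _ (hWO hx) _ (hWO hy), hn]

theorem map_br [LocallyConnectedSpace X] [LocallyConnectedSpace X']
    (S : IsLiftedSplitting L f D π F) (S' : IsLiftedSplitting L' f' D' π' F') {Φ : M → M'}
    (hΦ : Continuous Φ) (hΦF : ∀ x, Φ (F x) = F' (Φ x)) {h : X → X'} (hh : Continuous h)
    (hπ : ∀ x, h (π x) = π' (Φ x)) (a b : M) : Φ (D.br a b) = D'.br (Φ a) (Φ b) := by
  have hΦF' : ∀ x, Φ (F.symm x) = F'.symm (Φ x) := fun x => by
    apply F'.injective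
    rw [← hΦF, F.apply_symm_apply, F'.apply_symm_apply]
  have h₁ : D'.br (Φ b) (Φ (D.br a b)) = Φ b :=
    S.map_stable_plaque S' hΦ hΦF hh hπ (by rw [D.br_right, D.br_self])
  have h₂ : D'.br (Φ (D.br a b)) (Φ a) = Φ a :=
    S.op.map_stable_plaque S'.op hΦ hΦF' hh hπ ((D.br_left a b a).trans (D.br_self a))
  calc Φ (D.br a b) = D'.br (Φ a) (Φ (D.br a b)) := (D'.br_eq_right_iff.2 h₂).symm
    _ = D'.br (Φ a) (D'.br (Φ b) (Φ (D.br a b))) := (D'.br_right _ _ _).symm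
    _ = D'.br (Φ a) (Φ b) := by rw [h₁]

/-- If `Φ a = Φ b` with `a`, `b` in a stable plaque, then the pairs `(Fᵏ a, Fᵏ b)`, `k ∈ ℤ`, are
all bounded modulo deck transformations. As stable plaques are uniformly contracted, the
projections are close along the whole orbit, so expansivity applies. -/
theorem eq_of_stable_plaque_of_map_eq [LocallyConnectedSpace X] (S : IsLiftedSplitting L f D π F)
    {Φ : M → M'} (hΦF : ∀ x, Φ (F x) = F' (Φ x)) {K : Set (M × M)} (hK : IsCompact K)
    (hΦK : ∀ p q, Φ p = Φ q → ∃ g ∈ deckGroup D π, (g p, g q) ∈ K) {a b : M}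
    (hab : D.br a b = a) (h : Φ a = Φ b) : a = b := by
  obtain ⟨U, hU⟩ := S.smale.exists_isExpansiveNhd
  obtain ⟨N, hN⟩ := (S.eventually_close hK hU.mem_nhdsSet).exists
  refine S.eq_of_proj_eq (D.br_self a) hab (hU.expansive _ _ fun j => ?_)
  have h₁ := hN ((F ^ (j - N)) a) ((F ^ (j - N)) b)
    (hΦK _ _ (by rw [semiconj_zpow hΦF, semiconj_zpow hΦF, h])) (by rw [← S.zpow_br, hab])
  rwa [S.proj_zpow, S.proj_zpow, ← zpow_natCast_apply, ← zpow_natCast_apply, ← zpow_add_apply,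
    ← zpow_add_apply, add_sub_cancel] at h₁

/-- Every point `y` of the stable plaque of `Φ x₀` has a projection in the image of `π' ∘ Φ`. By
cocompactness there are points of the form `zₙ = [Φ xₙ, F'⁻ⁿ y]` at bounded distance from `F'⁻ⁿ y`.
The points `F'ⁿ zₙ` belong to the image of `Φ`, and their projections converge to that of `y` by
uniform contraction. -/
theorem proj_mem_range_of_stable_plaque [LocallyConnectedSpace X']
    (S' : IsLiftedSplitting L' f' D' π' F') {Φ : M → M'} (hΦF : ∀ x, Φ (F x) = F' (Φ x))
    (hΦbr : ∀ a b, Φ (D.br a b) = D'.br (Φ a) (Φ b)) (hrange : IsCompact (range (π' ∘ Φ)))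
    {x₀ : M} {K : Set M'} (hK : IsCompact K)
    (hΦK : ∀ y, ∃ g ∈ deckGroup D' π', ∃ x, g y ∈ K ∧ g (Φ x) = Φ x₀) {y : M'}
    (hy : D'.br (Φ x₀) y = Φ x₀) : π' y ∈ range (π' ∘ Φ) := by
  have := S'.smale.t2Space
  obtain ⟨U, hU⟩ := S'.smale.exists_isExpansiveNhd
  have hK' : IsCompact ((fun k => (k, D'.br (Φ x₀) k)) '' K) :=
    hK.image (continuous_id.prodMk (D'.continuous_br' continuous_const continuous_id))
  obtain ⟨N, hN⟩ := eventually_atTop.1 (S'.eventually_close hK' hU.mem_nhdsSet)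
  set T : ℕ → Set X' := fun n => range (π' ∘ Φ) ∩
    {w | ∀ j : ℤ, (N : ℤ) - n ≤ j → ((f' ^ j) (π' y), (f' ^ j) w) ∈ U}
  have hTc : ∀ n, IsClosed (T n) := fun n => by
    refine hrange.isClosed.inter ?_
    simp only [ofPred_forall]
    exact isClosed_iInter fun j => isClosed_iInter fun _ =>
      hU.isClosed.preimage (continuous_const.prodMk (f' ^ j).continuous)
  have hTne : ∀ n, (T n).Nonempty := by
    intro n
    obtain ⟨g, hg, x, hgK, hgx⟩ := hΦK ((F' ^ (-(n : ℤ))) y)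
    set yn := (F' ^ (-(n : ℤ))) y with hyn
    have hFyn : (F' ^ (n : ℤ)) yn = y := by
      rw [hyn, ← zpow_add_apply, add_neg_cancel, zpow_zero]; rfl
    refine ⟨π' ((F' ^ (n : ℤ)) (D'.br (Φ x) yn)), ⟨D.br ((F ^ (n : ℤ)) x) x₀, ?_⟩, ?_⟩
    · rw [Function.comp_apply, hΦbr, S'.zpow_br, hFyn, semiconj_zpow hΦF, ← hy, D'.br_right]
    · intro j hj
      obtain ⟨i, hi⟩ : ∃ i : ℕ, j + n = i := ⟨(j + n).toNat, by omega⟩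
      have h₁ := hN i (by omega) yn (D'.br (Φ x) yn)
        ⟨g, hg, g yn, hgK, by rw [hg.1, hgx]⟩ (by rw [D'.br_right, D'.br_self])
      rw [← zpow_natCast_apply, ← zpow_natCast_apply, ← hi, zpow_add_apply, zpow_add_apply,
        ← S'.proj_zpow n, ← S'.proj_zpow n, hFyn] at h₁
      exact h₁
  obtain ⟨w, hw⟩ := IsCompact.nonempty_iInter_of_sequence_nonempty_isCompact_isClosed T
    (fun n => inter_subset_inter_right _ fun w hw j hj => hw j (by push_cast; omega)) hTne
    (hrange.of_isClosed_subset (hTc 0) inter_subset_left) hTc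
  rw [mem_iInter] at hw
  have h : π' y = w := hU.expansive _ _ fun j => (hw (N - j).toNat).2 j (by omega)
  exact h ▸ (hw 0).1

end IsLiftedSplitting

end Smale

theorem mainTheorem5 {X₁ X₂ M₁ M₂ : Type*}
    [TopologicalSpace X₁] [TopologicalSpace X₂] [TopologicalSpace M₁] [TopologicalSpace M₂]
    [ConnectedSpace X₁] [LocallyConnectedSpace X₁] [ConnectedSpace X₂] [LocallyConnectedSpace X₂]
    (L₁ : Smale.LocalProduct X₁) (f₁ : X₁ ≃ₜ X₁) (hX₁ : Smale.IsSmaleSpace L₁ f₁)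
    (L₂ : Smale.LocalProduct X₂) (f₂ : X₂ ≃ₜ X₂) (hX₂ : Smale.IsSmaleSpace L₂ f₂)
    (D₁ : Smale.DirectProduct M₁) (π₁ : M₁ → X₁) (hπ₁ : Smale.IsSplitting L₁ f₁ D₁ π₁)
    (D₂ : Smale.DirectProduct M₂) (π₂ : M₂ → X₂) (hπ₂ : Smale.IsSplitting L₂ f₂ D₂ π₂)
    (F₁ : M₁ ≃ₜ M₁) (hF₁ : Smale.IsLift f₁ D₁ π₁ F₁) (hfix₁ : ∃ x : M₁, F₁ x = x)
    (F₂ : M₂ ≃ₜ M₂) (hF₂ : Smale.IsLift f₂ D₂ π₂ F₂) (hfix₂ : ∃ x : M₂, F₂ x = x)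
    (ψ : Smale.deckGroup D₁ π₁ ≃* Smale.deckGroup D₂ π₂)
    (Φ : M₁ → M₂) (hΦ : Continuous Φ)
    (hΦG : ∀ (g : Smale.deckGroup D₁ π₁) (x : M₁),
      Φ ((g : M₁ ≃ₜ M₁) x) = (ψ g : M₂ ≃ₜ M₂) (Φ x))
    (hΦF : ∀ x : M₁, Φ (F₁ x) = F₂ (Φ x)) :
    Smale.TopConjugate f₁ f₂ := by
  have S₁ : Smale.IsLiftedSplitting L₁ f₁ D₁ π₁ F₁ := ⟨hX₁, hπ₁, hF₁⟩
  have S₂ : Smale.IsLiftedSplitting L₂ f₂ D₂ π₂ F₂ := ⟨hX₂, hπ₂, hF₂⟩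
  have := hX₁.compact
  have := hX₂.t2Space
  -- The map `h` induced by `Φ` on the orbit spaces of the deck groups.
  obtain ⟨h, hh⟩ : ∃ h : X₁ → X₂, ∀ m, h (π₁ m) = π₂ (Φ m) := by
    refine ⟨fun x => π₂ (Φ (Function.surjInv hπ₁.surjective x)), fun m => ?_⟩
    obtain ⟨g, hg, hgm⟩ := S₁.exists_deck (Function.surjInv_eq hπ₁.surjective (π₁ m)).symm
    change π₂ (Φ (Function.surjInv hπ₁.surjective (π₁ m))) = π₂ (Φ m)
    rw [← hgm, hΦG ⟨g, hg⟩ m, (ψ ⟨g, hg⟩).2.2]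
  have hhc : Continuous h := by
    rw [(hπ₁.isCoveringMap.isQuotientMap hπ₁.surjective).continuous_iff]
    exact (S₂.continuous.comp hΦ).congr fun m => (hh m).symm
  have hhf : ∀ x, h (f₁ x) = f₂ (h x) := fun x => by
    obtain ⟨m, rfl⟩ := hπ₁.surjective x
    rw [← hF₁.comm, hh, hΦF, hF₂.comm, hh]
  have hbr := S₁.map_br S₂ hΦ hΦF hhc hh
  have hΦF' : ∀ x, Φ (F₁.symm x) = F₂.symm (Φ x) := fun x => by
    apply F₂.injective
    rw [← hΦF, F₁.apply_symm_apply, F₂.apply_symm_apply]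
  obtain ⟨K₁, hK₁, hK₁'⟩ := S₁.exists_isCompact_forall_exists_deck
  obtain ⟨K₂, hK₂, hK₂'⟩ := S₂.exists_isCompact_forall_exists_deck
  -- Points with equal images under `Φ` are at bounded distance modulo deck transformations.
  obtain ⟨K, hK, hΦK⟩ : ∃ K : Set (M₁ × M₁), IsCompact K ∧
      ∀ p q, Φ p = Φ q → ∃ g ∈ Smale.deckGroup D₁ π₁, (g p, g q) ∈ K := by
    have hfin : {g : Smale.deckGroup D₁ π₁ |
        ∃ a ∈ Φ '' K₁, (ψ g : M₂ ≃ₜ M₂) a ∈ Φ '' K₁}.Finite := by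
      refine Set.Finite.of_finite_image ((S₂.finite_deck (hK₁.image hΦ)).subset ?_)
        (f := fun g => (ψ g : M₂ ≃ₜ M₂)) (fun g _ g' _ hgg' => ψ.injective (Subtype.ext hgg'))
      rintro _ ⟨g, hg, rfl⟩
      exact ⟨(ψ g).2, hg⟩
    refine ⟨K₁ ×ˢ ⋃ g ∈ {g : Smale.deckGroup D₁ π₁ |
        ∃ a ∈ Φ '' K₁, (ψ g : M₂ ≃ₜ M₂) a ∈ Φ '' K₁}, (g : M₁ ≃ₜ M₁) '' K₁,
      hK₁.prod (hfin.isCompact_biUnion fun g _ => hK₁.image (g : M₁ ≃ₜ M₁).continuous),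
      fun p q hpq => ?_⟩
    obtain ⟨g, hg, hgp⟩ := hK₁' p
    obtain ⟨g', hg', hgq⟩ := hK₁' q
    have hgg' : (g * g'⁻¹) (g' q) = g q := congrArg g (g'.symm_apply_apply q)
    refine ⟨g, hg, hgp, Set.mem_biUnion (x := ⟨g, hg⟩ * ⟨g', hg'⟩⁻¹) ?_ ⟨g' q, hgq, hgg'⟩⟩
    refine ⟨Φ (g' q), Set.mem_image_of_mem Φ hgq, g p, hgp, ?_⟩
    rw [← hΦG]
    refine Eq.trans ?_ (congrArg Φ hgg').symm
    rw [hΦG ⟨g, hg⟩, hΦG ⟨g, hg⟩, hpq]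
  have hΦinj : Function.Injective Φ := by
    intro x y hxy
    have h₁ : x = D₁.br x y := by
      refine S₁.op.eq_of_stable_plaque_of_map_eq hΦF' hK (fun p q hpq => ?_)
        ((D₁.br_left x y x).trans (D₁.br_self x)) (by rw [hbr, ← hxy, D₂.br_self])
      obtain ⟨g, hg, hgK⟩ := hΦK p q hpq
      exact ⟨g, Smale.mem_deckGroup_op.2 hg, hgK⟩
    exact S₁.eq_of_stable_plaque_of_map_eq hΦF hK hΦK h₁.symm hxy
  have hinj : Function.Injective h := by
    intro x y hxy
    obtain ⟨a, rfl⟩ := hπ₁.surjective x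
    obtain ⟨b, rfl⟩ := hπ₁.surjective y
    rw [hh, hh] at hxy
    obtain ⟨γ, hγ, hγa⟩ := S₂.exists_deck hxy
    have h₁ := hΦG (ψ.symm ⟨γ, hγ⟩) a
    rw [ψ.apply_symm_apply] at h₁
    rw [← hΦinj (h₁.trans hγa), (ψ.symm ⟨γ, hγ⟩).2.2]
  have hrange : Set.range (π₂ ∘ Φ) = Set.range h := by
    rw [← hπ₁.surjective.range_comp h]
    exact congrArg Set.range (funext fun m => (hh m).symm)
  have hrangec : IsCompact (Set.range (π₂ ∘ Φ)) := hrange ▸ isCompact_range hhc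
  have hΦK₂ : ∀ x₀ y, ∃ g ∈ Smale.deckGroup D₂ π₂, ∃ x, g y ∈ K₂ ∧ g (Φ x) = Φ x₀ := by
    intro x₀ y
    obtain ⟨g, hg, hgy⟩ := hK₂' y
    refine ⟨g, hg, (ψ.symm ⟨g, hg⟩⁻¹ : M₁ ≃ₜ M₁) x₀, hgy, ?_⟩
    rw [hΦG, map_inv, map_inv, ψ.apply_symm_apply]
    exact g.apply_symm_apply _
  have hsurj : Function.Surjective h := by
    intro x
    obtain ⟨y, rfl⟩ := hπ₂.surjective x
    have : Nonempty M₁ := hπ₁.surjective.nonempty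
    obtain ⟨x₀⟩ := this
    rw [← Set.mem_range, ← hrange]
    -- First the unstable plaque of `Φ x₀`, then the stable plaques of its points.
    obtain ⟨x₁, hx₁⟩ : π₂ (D₂.br (Φ x₀) y) ∈ Set.range (π₂ ∘ Φ) := by
      refine S₂.op.proj_mem_range_of_stable_plaque (D := D₁.op) hΦF' (fun a b => hbr b a) hrangec
        hK₂ (x₀ := x₀) (fun y => ?_) ((D₂.br_left _ _ _).trans (D₂.br_self _))
      obtain ⟨g, hg, hg'⟩ := hΦK₂ x₀ y
      exact ⟨g, Smale.mem_deckGroup_op.2 hg, hg'⟩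
    obtain ⟨γ, hγ, hγx⟩ := S₂.exists_deck hx₁
    have h₁ := hΦG (ψ.symm ⟨γ, hγ⟩) x₁
    rw [ψ.apply_symm_apply] at h₁
    refine S₂.proj_mem_range_of_stable_plaque hΦF hbr hrangec hK₂ (hΦK₂ _) (y := y) (?_ :
      D₂.br (Φ ((ψ.symm ⟨γ, hγ⟩ : M₁ ≃ₜ M₁) x₁)) y = _)
    rw [h₁, hγx, D₂.br_left]
  exact ⟨hhc.homeoOfEquivCompactToT2 (f := Equiv.ofBijective h ⟨hinj, hsurj⟩), hhf⟩
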